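/- Let $\Theta$ be a Borel subset of a Polish space with its Borel $\sigma$-algebra, $\mu$ a $\sigma$-finite measure on $\Theta$, and $\mathbb{G}$ a stochastic kernel on $\Theta$ such that every $\mathbb{G}(\ell,\cdot)$ has a density $g(\ell,\cdot)\ge 0$ with respect to $\mu$. Let $\mathcal{H}_\infty^{a\times b}$ be the set of measurable, $\mu$-essentially bounded functions $\Theta\to\mathbb{R}^{a\times b}$, and $\mathcal{SH}_\infty^{a}$ the set of those in $\mathcal{H}_\infty^{a\times a}$ with symmetric values. Equations, inequalities and limits between such functions are understood pointwise for $\mu$-almost every $\ell$; $U\le V$ means that $V-U$ is positive semidefinite, and $U\gg 0$ means that there is a constant $\xi>0$ with $U(\ell)\ge\xi I$ for $\mu$-almost every $\ell$. Let $A\in\mathcal{H}_\infty^{n\times n}$, $G\in\mathcal{H}_\infty^{n\times m}$, $Q\in\mathcal{SH}_\infty^{n}$ and $R\in\mathcal{SH}_\infty^{m}$ with $R\gg 0$. For $P\in\mathcal{SH}_\infty^n$ put $\mathcal{E}(P)(\ell)=\int_\Theta g(\ell,t)P(t)\,\mu(dt)$, $\mathcal{T}_S(P)=S^T\mathcal{E}(P)S$,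 $\mathcal{G}(P)=G^T\mathcal{E}(P)A$, $\mathcal{R}(P)=R+\mathcal{T}_G(P)$, $\mathcal{M}(P)=-\mathcal{R}(P)^{-1}\mathcal{G}(P)$, $$\mathcal{W}(P)=-P+\mathcal{T}_A(P)+Q-\mathcal{G}(P)^T\mathcal{R}(P)^{-1}\mathcal{G}(P),$$ and $\mathbf{S}_+=\{P\in\mathcal{SH}_\infty^n:\ \mathcal{R}(P)\gg 0,\ \mathcal{W}(P)\ge 0\}$. Call $K\in\mathcal{H}_\infty^{m\times n}$ stabilizing if the system $x(k+1)=(A+GK)(\vartheta(k))\,x(k)$, $x(0)=x_0$, is exponentially mean-square stable: there are $\beta\ge 1$ and $\alpha\in(0,1)$ with $\mathbf{E}\|x(k)\|^2\le\beta\alpha^k\|x_0\|^2$ for all $k\in\mathbb{N}$, all deterministic $x_0\in\mathbb{R}^n$ and all Markov chains $\vartheta$ with transition kernel $\mathbb{G}$ and initial distribution absolutely continuous with respect to $\mu$. Theorem. Suppose that $(A,G|\mathbb{G})$ is exponentially mean-square stabilizable, i.e. a stabilizing $K$ exists, and that $\mathbf{S}_+\neq\emptyset$. Then the coupled algebraic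 Riccati equations $$P=\mathcal{T}_A(P)+Q-\mathcal{G}(P)^T\mathcal{R}(P)^{-1}\mathcal{G}(P)$$ have a solution $P_{\max}\in\mathcal{SH}_\infty^n$ that satisfies the sign condition $\mathcal{R}(P_{\max})\gg 0$ and is maximal over $\mathbf{S}_+$, i.e. $P\le P_{\max}$ for every $P\in\mathbf{S}_+$. Moreover, for every stabilizing $K_0$ the iteration in which $P_h\in\mathcal{SH}_\infty^n$ is the ($\mu$-a.e. unique) solution of $$P_h-\mathcal{T}_{A+GK_h}(P_h)=Q+K_h^TRK_h ,\qquad K_{h+1}=\mathcal{M}(P_h),\qquad h=0,1,2,\dots,$$ is well defined; every $K_h$ is stabilizing, $\mathcal{R}(P_h)\gg 0$, $P\le P_{h+1}\le P_h$ for all $P\in\mathbf{S}_+$ and all $h$, and $P_h(\ell)\to P_{\max}(\ell)$ for $\mu$-almost every $\ell\in\Theta$. -/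

import Mathlib

open MeasureTheory ProbabilityTheory Filter Topology

universe u

noncomputable section

namespace MJLS

/-! ### Spaces of matrix-valued functions -/

section Spaces

variable {Θ : Type u} [MeasurableSpace Θ]

/-- Matrix-valued functions on `Θ`. -/
abbrev MatFun (Θ : Type u) (a b : ℕ) : Type u := Θ → Matrix (Fin a) (Fin b) ℝ

open scoped Matrix.Norms.L2Operator in
/-- `Q ∈ H_∞^{a × b}`: measurable, with `μ`-essentially bounded operator norm
(the operator norm is taken with respect to the Euclidean norms). -/
def MemH (μ : Measure Θ) {a b : ℕ} (Q : MatFun Θ a b) : Prop :=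
  (∀ i j, Measurable fun ℓ => Q ℓ i j) ∧ ∃ c : ℝ, ∀ᵐ ℓ ∂μ, ‖Q ℓ‖ ≤ c

/-- `Q ∈ SH_∞^a`: an element of `H_∞^{a × a}` with values in the symmetric matrices. -/
def MemSH (μ : Measure Θ) {a : ℕ} (Q : MatFun Θ a a) : Prop :=
  MemH μ Q ∧ ∀ ℓ, (Q ℓ).transpose = Q ℓ

/-- `U ≤ V` `μ`-almost everywhere in the order of symmetric matrices. -/
def LeAE (μ : Measure Θ) {a : ℕ} (U V : MatFun Θ a a) : Prop :=
  ∀ᵐ ℓ ∂μ, (V ℓ - U ℓ).PosSemidef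

/-- `Q(ℓ) ≫ 0` `μ`-a.e.: `Q(ℓ) ≥ ξ I` for `μ`-almost all `ℓ`, for some constant `ξ > 0`. -/
def UnifPos (μ : Measure Θ) {a : ℕ} (Q : MatFun Θ a a) : Prop :=
  ∃ ξ : ℝ, 0 < ξ ∧ ∀ᵐ ℓ ∂μ, (Q ℓ - ξ • (1 : Matrix (Fin a) (Fin a) ℝ)).PosSemidef

end Spaces

/-! ### Markov chains, mean-square stability and stabilizability -/

section Stability

variable {Θ : Type u} [MeasurableSpace Θ]

/-- The `σ`-algebra generated by `ϑ 0, …, ϑ k`. -/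
abbrev history {Ω : Type u} (ϑ : ℕ → Ω → Θ) (k : ℕ) : MeasurableSpace Ω :=
  ⨆ i : Fin (k + 1), MeasurableSpace.comap (ϑ i) inferInstance

/-- `ϑ` is a homogeneous Markov chain on `(Ω, Pr)` with transition kernel `𝔾`:
`Pr(ϑ (k+1) ∈ Λ | ϑ 0, …, ϑ k) = 𝔾 (ϑ k) Λ` almost surely. -/
structure IsMarkovChain (𝔾 : Kernel Θ Θ) {Ω : Type u} [MeasurableSpace Ω]
    (Pr : Measure Ω) (ϑ : ℕ → Ω → Θ) : Prop where
  measurable : ∀ k, Measurable (ϑ k)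
  markov : ∀ (k : ℕ) (Λ : Set Θ), MeasurableSet Λ →
    Pr⟦ϑ (k + 1) ⁻¹' Λ | history ϑ k⟧ =ᵐ[Pr] fun ω => (𝔾 (ϑ k ω)).real Λ

/-- The state of `x(k+1) = A(ϑ(k)) x(k)`, `x(0) = x₀`, along a path `θ` of the chain. -/
def state {n : ℕ} (A : MatFun Θ n n) (θ : ℕ → Θ) (x₀ : EuclideanSpace ℝ (Fin n)) :
    ℕ → EuclideanSpace ℝ (Fin n)
  | 0 => x₀
  | k + 1 => WithLp.toLp 2 ((A (θ k)).mulVec (state A θ x₀ k).ofLp)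

/-- `(A|𝔾)` is exponentially mean-square stable (EMSS): there are `β ≥ 1` and `α ∈ (0,1)` with
`𝔼 ‖x(k)‖² ≤ β αᵏ ‖x₀‖²` for all `k`, every deterministic `x₀`, and every chain with transition
kernel `𝔾` whose initial distribution is absolutely continuous with respect to `μ`. -/
def EMSS (μ : Measure Θ) (𝔾 : Kernel Θ Θ) {n : ℕ} (A : MatFun Θ n n) : Prop :=
  ∃ β α : ℝ, 1 ≤ β ∧ 0 < α ∧ α < 1 ∧
    ∀ (Ω : Type u) [MeasurableSpace Ω] (Pr : Measure Ω) [IsProbabilityMeasure Pr]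
      (ϑ : ℕ → Ω → Θ), IsMarkovChain 𝔾 Pr ϑ → Pr.map (ϑ 0) ≪ μ →
      ∀ (x₀ : EuclideanSpace ℝ (Fin n)) (k : ℕ),
        ∫⁻ ω, ENNReal.ofReal (‖state A (fun i => ϑ i ω) x₀ k‖ ^ 2) ∂Pr
          ≤ ENNReal.ofReal (β * α ^ k * ‖x₀‖ ^ 2)

/-- `K` is a stabilizing feedback gain: `u(k) = K(ϑ(k)) x(k)` exponentially stabilizes
`(A, G|𝔾)`. -/
def IsStabilizingGain (μ : Measure Θ) (𝔾 : Kernel Θ Θ) {n m : ℕ} (A : MatFun Θ n n)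
    (G : MatFun Θ n m) (K : MatFun Θ m n) : Prop :=
  MemH μ K ∧ EMSS μ 𝔾 (fun ℓ => A ℓ + G ℓ * K ℓ)

/-- `(A, G|𝔾)` is exponentially mean-square stabilizable. -/
def Stabilizable (μ : Measure Θ) (𝔾 : Kernel Θ Θ) {n m : ℕ} (A : MatFun Θ n n)
    (G : MatFun Θ n m) : Prop :=
  ∃ K : MatFun Θ m n, IsStabilizingGain μ 𝔾 A G K

end Stability

/-! ### The Riccati operators; `g ℓ t` is the transition density with respect to `μ` -/

section Riccati

variable {Θ : Type u} [MeasurableSpace Θ]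

/-- `E(U)(ℓ) = ∫ g(ℓ,t) U(t) μ(dt)` (entrywise integral). -/
def opE (μ : Measure Θ) (g : Θ → Θ → ℝ) {a b : ℕ} (U : MatFun Θ a b) : MatFun Θ a b :=
  fun ℓ => Matrix.of fun i j => ∫ t, g ℓ t * U t i j ∂μ

/-- `T_S(U)(ℓ) = S(ℓ)ᵀ E(U)(ℓ) S(ℓ)`. -/
def opT (μ : Measure Θ) (g : Θ → Θ → ℝ) {a b : ℕ} (S : MatFun Θ a b) (U : MatFun Θ a a) :
    MatFun Θ b b :=
  fun ℓ => (S ℓ).transpose * opE μ g U ℓ * S ℓ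

variable {n m : ℕ}

/-- `𝒢(P)(ℓ) = G(ℓ)ᵀ E(P)(ℓ) A(ℓ)`. -/
def opG (μ : Measure Θ) (g : Θ → Θ → ℝ) (A : MatFun Θ n n) (G : MatFun Θ n m)
    (P : MatFun Θ n n) : MatFun Θ m n :=
  fun ℓ => (G ℓ).transpose * opE μ g P ℓ * A ℓ

/-- `ℛ(P)(ℓ) = R(ℓ) + T_G(P)(ℓ)`. -/
def opR (μ : Measure Θ) (g : Θ → Θ → ℝ) (G : MatFun Θ n m) (R : MatFun Θ m m)
    (P : MatFun Θ n n) : MatFun Θ m m :=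
  fun ℓ => R ℓ + opT μ g G P ℓ

/-- `ℳ(P)(ℓ) = -ℛ(P)(ℓ)⁻¹ 𝒢(P)(ℓ)`. -/
def opM (μ : Measure Θ) (g : Θ → Θ → ℝ) (A : MatFun Θ n n) (G : MatFun Θ n m)
    (R : MatFun Θ m m) (P : MatFun Θ n n) : MatFun Θ m n :=
  fun ℓ => -((opR μ g G R P ℓ)⁻¹ * opG μ g A G P ℓ)

/-- The right-hand side `T_A(P)(ℓ) + Q(ℓ) - 𝒢(P)(ℓ)ᵀ ℛ(P)(ℓ)⁻¹ 𝒢(P)(ℓ)` of the coupled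
algebraic Riccati equations. -/
def riccatiRHS (μ : Measure Θ) (g : Θ → Θ → ℝ) (A : MatFun Θ n n) (G : MatFun Θ n m)
    (Q : MatFun Θ n n) (R : MatFun Θ m m) (P : MatFun Θ n n) : MatFun Θ n n :=
  fun ℓ => opT μ g A P ℓ + Q ℓ -
    (opG μ g A G P ℓ).transpose * (opR μ g G R P ℓ)⁻¹ * opG μ g A G P ℓ

/-- `𝒲(P) = -P + T_A(P) + Q - 𝒢(P)ᵀ ℛ(P)⁻¹ 𝒢(P)`. -/
def opW (μ : Measure Θ) (g : Θ → Θ → ℝ) (A : MatFun Θ n n) (G : MatFun Θ n m)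
    (Q : MatFun Θ n n) (R : MatFun Θ m m) (P : MatFun Θ n n) : MatFun Θ n n :=
  fun ℓ => -P ℓ + riccatiRHS μ g A G Q R P ℓ

/-- The set `S₊` of all `P ∈ SH_∞^n` with `ℛ(P) ≫ 0` and `𝒲(P) ≥ 0` `μ`-a.e. -/
def SPlus (μ : Measure Θ) (g : Θ → Θ → ℝ) (A : MatFun Θ n n) (G : MatFun Θ n m)
    (Q : MatFun Θ n n) (R : MatFun Θ m m) : Set (MatFun Θ n n) :=
  {P | MemSH μ P ∧ UnifPos μ (opR μ g G R P) ∧ ∀ᵐ ℓ ∂μ, (opW μ g A G Q R P ℓ).PosSemidef}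

/-- `P` is a solution in `SH_∞^n` of the coupled algebraic Riccati equations. -/
def IsRiccatiSolution (μ : Measure Θ) (g : Θ → Θ → ℝ) (A : MatFun Θ n n) (G : MatFun Θ n m)
    (Q : MatFun Θ n n) (R : MatFun Θ m m) (P : MatFun Θ n n) : Prop :=
  MemSH μ P ∧ ∀ᵐ ℓ ∂μ, P ℓ = riccatiRHS μ g A G Q R P ℓ

/-- `P` is the maximal solution of the coupled algebraic Riccati equations over `S₊`. -/
def IsMaximalSolution (μ : Measure Θ) (g : Θ → Θ → ℝ) (A : MatFun Θ n n) (G : MatFun Θ n m)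
    (Q : MatFun Θ n n) (R : MatFun Θ m m) (P : MatFun Θ n n) : Prop :=
  IsRiccatiSolution μ g A G Q R P ∧ ∀ P' ∈ SPlus μ g A G Q R, LeAE μ P' P

/-- `P ∈ SH_∞^n` solves the coupled Lyapunov equation `P - T_{A+GK}(P) = Q + Kᵀ R K`. -/
def IsLyapunovSolution (μ : Measure Θ) (g : Θ → Θ → ℝ) (A : MatFun Θ n n) (G : MatFun Θ n m)
    (Q : MatFun Θ n n) (R : MatFun Θ m m) (K : MatFun Θ m n) (P : MatFun Θ n n) : Prop :=
  MemSH μ P ∧ ∀ᵐ ℓ ∂μ,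
    P ℓ - opT μ g (fun t => A t + G t * K t) P ℓ = Q ℓ + (K ℓ).transpose * R ℓ * K ℓ

/-- The Kleinman-type iteration started at the gain `K₀`: `K 0 = K₀`, `K (h+1) = ℳ(P h)`, and
`P h` solves the Lyapunov equation with gain `K h`. -/
structure IsKleinmanIteration (μ : Measure Θ) (g : Θ → Θ → ℝ) (A : MatFun Θ n n)
    (G : MatFun Θ n m) (Q : MatFun Θ n n) (R : MatFun Θ m m) (K₀ : MatFun Θ m n)
    (K : ℕ → MatFun Θ m n) (P : ℕ → MatFun Θ n n) : Prop where
  init : K 0 = K₀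
  step : ∀ h, K (h + 1) = opM μ g A G R (P h)
  lyapunov : ∀ h, IsLyapunovSolution μ g A G Q R (K h) (P h)

end Riccati

end MJLS

end

open MJLS

noncomputable section

namespace MJLS

open scoped Matrix MatrixOrder

/-! ### Real symmetric matrices -/

section MatrixLemmas

variable {a b c : ℕ}

/-! Probability enters only through one equivalence, `emss_iff_lyapunovStable`: mean-square
stability of `A` amounts to a bounded `V ≥ 0` with `V - T_A(V) ≫ 0`. The rest is order theory for
the positive linear operator `T_A`. Such a `V` gives `T_A(V) ≤ ρ V` with `ρ < 1`, so `T_A(D) ≤ D`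
forces `D ≥ 0` (`LyapunovStable.nonneg_of_opT_le`). This yields comparison and uniqueness for
Lyapunov equations; monotone iteration yields existence.

The algebraic core is completion of squares (`sub_opT_closedLoop`): `P - T_{A+GK}(P)` equals `Q +
KᵀRK - 𝒲(P)` minus the square of `K - ℳ(P)` weighted by `ℛ(P)`. Subtracting two instances with the
same gain gives every inequality needed: an iterate dominates `S₊`, the iterates decrease, and the
difference between an iterate and an element of `S₊` bounds the energy of the gain change. By
`LyapunovStable.of_feedback` that bound keeps the next gain stabilizing.

The iterates therefore decrease to a limit above `S₊`. There `ℛ` stays uniformly positive, so the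
gains converge, their increments vanish, and `𝒲` of the limit is zero. The limit itself lies in
`S₊`, so limits from different initial gains dominate each other and coincide. -/

lemma posSemidef_iff_quadForm {M : Matrix (Fin a) (Fin a) ℝ} :
    M.PosSemidef ↔ Mᵀ = M ∧ ∀ x : Fin a → ℝ, 0 ≤ x ⬝ᵥ (M *ᵥ x) := by
  rw [Matrix.posSemidef_iff_dotProduct_mulVec]
  simp [Matrix.IsHermitian, Matrix.conjTranspose_eq_transpose_of_trivial]

lemma transpose_eq_of_posSemidef {M : Matrix (Fin a) (Fin a) ℝ} (h : M.PosSemidef) : Mᵀ = M :=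
  (posSemidef_iff_quadForm.1 h).1

lemma quadForm_mono {M N : Matrix (Fin a) (Fin a) ℝ} (h : M ≤ N) (x : Fin a → ℝ) :
    x ⬝ᵥ (M *ᵥ x) ≤ x ⬝ᵥ (N *ᵥ x) := by
  have := (posSemidef_iff_quadForm.1 (Matrix.le_iff.1 h)).2 x
  rw [Matrix.sub_mulVec, dotProduct_sub] at this
  linarith

lemma le_iff_quadForm {M N : Matrix (Fin a) (Fin a) ℝ} (hM : Mᵀ = M) (hN : Nᵀ = N) :
    M ≤ N ↔ ∀ x : Fin a → ℝ, x ⬝ᵥ (M *ᵥ x) ≤ x ⬝ᵥ (N *ᵥ x) := by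
  refine ⟨quadForm_mono, fun h => ?_⟩
  rw [Matrix.le_iff, posSemidef_iff_quadForm]
  refine ⟨by rw [Matrix.transpose_sub, hM, hN], fun x => ?_⟩
  rw [Matrix.sub_mulVec, dotProduct_sub]
  linarith [h x]

lemma quadForm_eq_sum (M : Matrix (Fin a) (Fin a) ℝ) (x : Fin a → ℝ) :
    x ⬝ᵥ (M *ᵥ x) = ∑ i, ∑ j, x i * (M i j * x j) := by
  simp [dotProduct, Matrix.mulVec, Finset.mul_sum]

lemma abs_quadForm_le {M : Matrix (Fin a) (Fin a) ℝ} {r : ℝ} (h : ∀ i j, |M i j| ≤ r)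
    (x : Fin a → ℝ) : |x ⬝ᵥ (M *ᵥ x)| ≤ (r * a) * (x ⬝ᵥ x) := by
  rw [quadForm_eq_sum]
  have key : ∀ i j, |x i * (M i j * x j)| ≤ r / 2 * x i ^ 2 + r / 2 * x j ^ 2 := by
    intro i j
    have hr : 0 ≤ r := (abs_nonneg _).trans (h i j)
    rw [abs_mul, abs_mul]
    have h1 : |x i| * (|M i j| * |x j|) ≤ |x i| * (r * |x j|) := by
      gcongr
      exact h i j
    have h2 := mul_nonneg hr (sq_nonneg (|x i| - |x j|))
    have h3 := sq_abs (x i)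
    have h4 := sq_abs (x j)
    nlinarith
  calc |∑ i, ∑ j, x i * (M i j * x j)|
      ≤ ∑ i, ∑ j, (r / 2 * x i ^ 2 + r / 2 * x j ^ 2) :=
        (Finset.abs_sum_le_sum_abs _ _).trans (Finset.sum_le_sum fun i _ =>
          (Finset.abs_sum_le_sum_abs _ _).trans (Finset.sum_le_sum fun j _ => key i j))
    _ = (r * a) * (x ⬝ᵥ x) := by
        simp only [Finset.sum_add_distrib, Finset.sum_const, Finset.card_univ, Fintype.card_fin,
          nsmul_eq_mul, dotProduct, ← Finset.mul_sum, ← pow_two]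
        ring

lemma quadForm_smul_one (r : ℝ) (x : Fin a → ℝ) :
    x ⬝ᵥ ((r • (1 : Matrix (Fin a) (Fin a) ℝ)) *ᵥ x) = r * (x ⬝ᵥ x) := by
  simp [Matrix.smul_mulVec]

lemma transpose_smul_one (r : ℝ) :
    (r • (1 : Matrix (Fin a) (Fin a) ℝ))ᵀ = r • 1 := by simp

lemma le_smul_one_of_abs_entry_le {M : Matrix (Fin a) (Fin a) ℝ} {r : ℝ} (hM : Mᵀ = M)
    (h : ∀ i j, |M i j| ≤ r) : M ≤ (r * a) • 1 := by
  rw [le_iff_quadForm hM (transpose_smul_one _)]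
  intro x
  rw [quadForm_smul_one]
  exact (abs_le.1 (abs_quadForm_le h x)).2

lemma neg_smul_one_le_of_abs_entry_le {M : Matrix (Fin a) (Fin a) ℝ} {r : ℝ} (hM : Mᵀ = M)
    (h : ∀ i j, |M i j| ≤ r) : (-(r * a)) • 1 ≤ M := by
  rw [le_iff_quadForm (transpose_smul_one _) hM]
  intro x
  rw [quadForm_smul_one]
  linarith [(abs_le.1 (abs_quadForm_le h x)).1]

/-- Polarization. -/
lemma two_mul_entry {M : Matrix (Fin a) (Fin a) ℝ} (hM : Mᵀ = M) (i j : Fin a) :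
    2 * M i j = (Pi.single i 1 + Pi.single j 1) ⬝ᵥ (M *ᵥ (Pi.single i 1 + Pi.single j 1))
      - (Pi.single i 1 ⬝ᵥ (M *ᵥ Pi.single i 1)) - (Pi.single j 1 ⬝ᵥ (M *ᵥ Pi.single j 1)) := by
  have h : M j i = M i j := by conv_lhs => rw [← hM, Matrix.transpose_apply]
  simp [Matrix.mulVec_add, add_dotProduct, dotProduct_add, h]
  ring

lemma abs_entry_le_of_posSemidef {M : Matrix (Fin a) (Fin a) ℝ} (hM : M.PosSemidef) {r : ℝ}
    (h : ∀ i, M i i ≤ r) (i j : Fin a) : |M i j| ≤ r := by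
  obtain ⟨hs, hq⟩ := posSemidef_iff_quadForm.1 hM
  have hji : M j i = M i j := by conv_lhs => rw [← hs, Matrix.transpose_apply]
  have h1 := hq (Pi.single i 1 + Pi.single j 1)
  have h2 := hq (Pi.single i 1 - Pi.single j 1)
  simp [Matrix.mulVec_add, Matrix.mulVec_sub, add_dotProduct, sub_dotProduct, dotProduct_add,
    dotProduct_sub, hji] at h1 h2
  rw [abs_le]
  constructor <;> linarith [h i, h j]

lemma entry_self_mono {M N : Matrix (Fin a) (Fin a) ℝ} (h : M ≤ N) (i : Fin a) :
    M i i ≤ N i i := by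
  have := quadForm_mono h (Pi.single i 1)
  simpa using this

lemma quadForm_conj (X : Matrix (Fin a) (Fin a) ℝ) (S : Matrix (Fin a) (Fin b) ℝ)
    (x : Fin b → ℝ) : x ⬝ᵥ ((Sᵀ * X * S) *ᵥ x) = (S *ᵥ x) ⬝ᵥ (X *ᵥ (S *ᵥ x)) := by
  rw [← Matrix.mulVec_mulVec, ← Matrix.mulVec_mulVec, Matrix.dotProduct_mulVec,
    Matrix.vecMul_transpose]

lemma conj_mono {X Y : Matrix (Fin a) (Fin a) ℝ} (h : X ≤ Y) (S : Matrix (Fin a) (Fin b) ℝ) :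
    Sᵀ * X * S ≤ Sᵀ * Y * S := by
  rw [Matrix.le_iff] at *
  have := h.conjTranspose_mul_mul_same S
  rwa [Matrix.conjTranspose_eq_transpose_of_trivial, Matrix.mul_sub, Matrix.sub_mul] at this

lemma conj_nonneg {X : Matrix (Fin a) (Fin a) ℝ} (h : 0 ≤ X) (S : Matrix (Fin a) (Fin b) ℝ) :
    0 ≤ Sᵀ * X * S := by
  simpa using conj_mono h S

lemma smul_mono_of_nonneg {X Y : Matrix (Fin a) (Fin a) ℝ} (h : X ≤ Y) {r : ℝ} (hr : 0 ≤ r) :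
    r • X ≤ r • Y := by
  rw [Matrix.le_iff] at *
  rw [← smul_sub]
  exact h.smul hr

lemma smul_one_mono {r s : ℝ} (h : r ≤ s) :
    r • (1 : Matrix (Fin a) (Fin a) ℝ) ≤ s • 1 := by
  rw [Matrix.le_iff, ← sub_smul]
  exact Matrix.PosSemidef.one.smul (sub_nonneg.2 h)

lemma smul_one_nonneg {r : ℝ} (h : 0 ≤ r) : 0 ≤ r • (1 : Matrix (Fin a) (Fin a) ℝ) := by
  simpa using smul_one_mono (a := a) h

/-- Young's inequality for the quadratic map `F ↦ Fᵀ X F`. -/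
lemma conj_add_le {X : Matrix (Fin a) (Fin a) ℝ} (hX : 0 ≤ X) (F H : Matrix (Fin a) (Fin b) ℝ)
    {ε : ℝ} (hε : 0 < ε) :
    (F + H)ᵀ * X * (F + H) ≤ (1 + ε) • (Fᵀ * X * F) + (1 + ε⁻¹) • (Hᵀ * X * H) := by
  -- The gap between the two sides is exactly `ε⁻¹ (εF - H)ᵀ X (εF - H)`.
  have h := smul_mono_of_nonneg (conj_nonneg hX (ε • F - H)) (inv_nonneg.2 hε.le)
  rw [smul_zero] at h
  rw [← sub_nonneg]
  convert h using 1
  simp only [Matrix.transpose_add, Matrix.transpose_sub, Matrix.transpose_smul, Matrix.add_mul,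
    Matrix.sub_mul, Matrix.mul_add, Matrix.mul_sub, Matrix.smul_mul, Matrix.mul_smul, smul_sub,
    add_smul, one_smul, smul_smul, inv_mul_cancel₀ hε.ne',
    inv_mul_cancel_left₀ hε.ne']
  abel

lemma isUnit_det_of_smul_one_le {M : Matrix (Fin a) (Fin a) ℝ} {ξ : ℝ} (hξ : 0 < ξ)
    (h : ξ • 1 ≤ M) : IsUnit M.det := by
  have h1 : M.PosDef := by
    have := (Matrix.PosDef.one (n := Fin a) (R := ℝ)).smul hξ
    simpa using this.add_posSemidef (Matrix.le_iff.1 h)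
  exact (Matrix.isUnit_iff_isUnit_det _).1 h1.isUnit

lemma inv_transpose_of_symm {M : Matrix (Fin a) (Fin a) ℝ} (h : Mᵀ = M) : M⁻¹ᵀ = M⁻¹ := by
  rw [Matrix.transpose_nonsing_inv, h]

lemma inv_nonneg_of_smul_one_le {M : Matrix (Fin a) (Fin a) ℝ} {ξ : ℝ} (hξ : 0 < ξ)
    (h : ξ • 1 ≤ M) : 0 ≤ M⁻¹ := by
  have h0 : 0 ≤ M := (smul_one_nonneg hξ.le).trans h
  exact Matrix.nonneg_iff_posSemidef.2 (Matrix.nonneg_iff_posSemidef.1 h0).inv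

lemma inv_le_smul_one {M : Matrix (Fin a) (Fin a) ℝ} {ξ : ℝ} (hξ : 0 < ξ)
    (h : ξ • 1 ≤ M) : M⁻¹ ≤ ξ⁻¹ • 1 := by
  have hu := isUnit_det_of_smul_one_le hξ h
  have h0 : 0 ≤ M := (smul_one_nonneg hξ.le).trans h
  have hs : M⁻¹ᵀ = M⁻¹ :=
    inv_transpose_of_symm (transpose_eq_of_posSemidef (Matrix.nonneg_iff_posSemidef.1 h0))
  -- This uses `ξ⁻¹ - M⁻¹ = M⁻¹ (M - ξ) M⁻¹ + ξ (M⁻¹ - ξ⁻¹)²`, a sum of two nonnegative terms.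
  have h1 := conj_nonneg (sub_nonneg.2 h) M⁻¹
  have h2 := smul_mono_of_nonneg (conj_nonneg (zero_le_one (α := Matrix (Fin a) (Fin a) ℝ))
    (M⁻¹ - ξ⁻¹ • 1)) hξ.le
  rw [smul_zero] at h2
  rw [← sub_nonneg]
  convert add_nonneg h1 h2 using 1
  simp only [Matrix.transpose_sub, Matrix.transpose_smul, Matrix.transpose_one, hs, Matrix.mul_sub,
    Matrix.sub_mul, Matrix.nonsing_inv_mul _ hu, Matrix.one_mul, Matrix.mul_one, Matrix.smul_mul,
    Matrix.mul_smul, smul_sub, smul_smul, mul_inv_cancel₀ hξ.ne', one_smul,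
    mul_inv_cancel_left₀ hξ.ne']
  abel

end MatrixLemmas

/-! ### The spaces `H_∞` and `SH_∞` -/

section FunctionSpaces

variable {Θ : Type u} [MeasurableSpace Θ] {μ : Measure Θ} {a b c : ℕ}

open scoped Matrix.Norms.L2Operator in
lemma exists_norm_le_of_abs_entry_le (a b : ℕ) : ∃ C : ℝ, ∀ (M : Matrix (Fin a) (Fin b) ℝ) (r : ℝ),
    (∀ i j, |M i j| ≤ r) → ‖M‖ ≤ C * r := by
  refine ⟨∑ i : Fin a, ∑ j : Fin b, ‖Matrix.single i j (1 : ℝ)‖, fun M r h => ?_⟩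
  conv_lhs => rw [Matrix.matrix_eq_sum_single M]
  rw [Finset.sum_mul]
  refine (norm_sum_le _ _).trans (Finset.sum_le_sum fun i _ => ?_)
  rw [Finset.sum_mul]
  refine (norm_sum_le _ _).trans (Finset.sum_le_sum fun j _ => ?_)
  have : Matrix.single i j (M i j) = M i j • Matrix.single i j (1 : ℝ) := by
    rw [Matrix.smul_single, smul_eq_mul, mul_one]
  rw [this, norm_smul, mul_comm, Real.norm_eq_abs]
  gcongr
  exact h i j

open scoped Matrix.Norms.L2Operator in
lemma exists_abs_entry_le (a b : ℕ) : ∃ C : ℝ, ∀ (M : Matrix (Fin a) (Fin b) ℝ),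
    ∀ i j, |M i j| ≤ C * ‖M‖ := by
  have h : ∀ i j, ∃ C : ℝ, 0 ≤ C ∧ ∀ M : Matrix (Fin a) (Fin b) ℝ, |M i j| ≤ C * ‖M‖ := by
    intro i j
    let f : Matrix (Fin a) (Fin b) ℝ →L[ℝ] ℝ :=
      (Matrix.entryLinearMap ℝ ℝ i j).toContinuousLinearMap
    exact ⟨‖f‖, f.opNorm_nonneg, fun M => f.le_opNorm M⟩
  choose C hC0 hC using h
  refine ⟨∑ i, ∑ j, C i j, fun M i j => (hC i j M).trans ?_⟩
  gcongr
  calc C i j ≤ ∑ j, C i j := Finset.single_le_sum (fun j _ => hC0 i j) (Finset.mem_univ j)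
    _ ≤ _ := Finset.single_le_sum (f := fun i => ∑ j, C i j)
      (fun i _ => Finset.sum_nonneg fun j _ => hC0 i j) (Finset.mem_univ i)

open scoped Matrix.Norms.L2Operator in
lemma memH_iff {U : MatFun Θ a b} : MemH μ U ↔
    (∀ i j, Measurable fun ℓ => U ℓ i j) ∧ ∃ r : ℝ, 0 ≤ r ∧ ∀ᵐ ℓ ∂μ, ∀ i j, |U ℓ i j| ≤ r := by
  constructor
  · rintro ⟨hm, c, hc⟩
    obtain ⟨C, hC⟩ := exists_abs_entry_le a b
    refine ⟨hm, |C| * |c|, by positivity, hc.mono fun ℓ hℓ i j => (hC _ i j).trans ?_⟩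
    exact mul_le_mul (le_abs_self _) (hℓ.trans (le_abs_self _)) (norm_nonneg (U ℓ)) (abs_nonneg _)
  · rintro ⟨hm, r, -, hr⟩
    obtain ⟨C, hC⟩ := exists_norm_le_of_abs_entry_le a b
    exact ⟨hm, C * r, hr.mono fun ℓ hℓ => hC _ _ hℓ⟩

lemma MemH.add {U V : MatFun Θ a b} (hU : MemH μ U) (hV : MemH μ V) :
    MemH μ (fun ℓ => U ℓ + V ℓ) := by
  rw [memH_iff] at *
  obtain ⟨mU, r, hr, bU⟩ := hU
  obtain ⟨mV, s, hs, bV⟩ := hV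
  refine ⟨fun i j => (mU i j).add (mV i j), r + s, by positivity, ?_⟩
  filter_upwards [bU, bV] with ℓ h1 h2 i j
  exact (abs_add_le _ _).trans (add_le_add (h1 i j) (h2 i j))

lemma MemH.const_smul {U : MatFun Θ a b} (hU : MemH μ U) (r : ℝ) :
    MemH μ (fun ℓ => r • U ℓ) := by
  rw [memH_iff] at *
  obtain ⟨mU, s, hs, bU⟩ := hU
  refine ⟨fun i j => (mU i j).const_mul r, |r| * s, by positivity, ?_⟩
  filter_upwards [bU] with ℓ h1 i j
  rw [Matrix.smul_apply, smul_eq_mul, abs_mul]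
  gcongr
  exact h1 i j

lemma MemH.neg {U : MatFun Θ a b} (hU : MemH μ U) : MemH μ (fun ℓ => -U ℓ) := by
  simpa using hU.const_smul (-1)

lemma MemH.sub {U V : MatFun Θ a b} (hU : MemH μ U) (hV : MemH μ V) :
    MemH μ (fun ℓ => U ℓ - V ℓ) := by
  simpa [sub_eq_add_neg] using hU.add hV.neg

lemma MemH.transpose {U : MatFun Θ a b} (hU : MemH μ U) : MemH μ (fun ℓ => (U ℓ)ᵀ) := by
  rw [memH_iff] at *
  obtain ⟨mU, s, hs, bU⟩ := hU
  exact ⟨fun i j => mU j i, s, hs, bU.mono fun ℓ h i j => h j i⟩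

lemma MemH.mul {U : MatFun Θ a b} {V : MatFun Θ b c} (hU : MemH μ U) (hV : MemH μ V) :
    MemH μ (fun ℓ => U ℓ * V ℓ) := by
  rw [memH_iff] at *
  obtain ⟨mU, r, hr, bU⟩ := hU
  obtain ⟨mV, s, hs, bV⟩ := hV
  refine ⟨fun i j => ?_, b * (r * s), by positivity, ?_⟩
  · simp only [Matrix.mul_apply]
    exact Finset.measurable_sum _ fun k _ => (mU i k).mul (mV k j)
  · filter_upwards [bU, bV] with ℓ h1 h2 i j
    rw [Matrix.mul_apply]
    calc |∑ k, U ℓ i k * V ℓ k j| ≤ ∑ k, |U ℓ i k * V ℓ k j| := Finset.abs_sum_le_sum_abs _ _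
      _ ≤ ∑ _k : Fin b, r * s := Finset.sum_le_sum fun k _ => by
          rw [abs_mul]
          exact mul_le_mul (h1 i k) (h2 k j) (abs_nonneg _) hr
      _ = b * (r * s) := by simp

lemma memH_const (M : Matrix (Fin a) (Fin b) ℝ) : MemH μ (fun _ => M) := by
  rw [memH_iff]
  refine ⟨fun i j => measurable_const, ∑ i, ∑ j, |M i j|,
    Finset.sum_nonneg fun i _ => Finset.sum_nonneg fun j _ => abs_nonneg _,
    ae_of_all _ fun _ i j => ?_⟩
  calc |M i j| ≤ ∑ j, |M i j| :=
        Finset.single_le_sum (f := fun j => |M i j|) (fun j _ => abs_nonneg _) (Finset.mem_univ j)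
    _ ≤ _ := Finset.single_le_sum (f := fun i => ∑ j, |M i j|)
      (fun i _ => Finset.sum_nonneg fun j _ => abs_nonneg _) (Finset.mem_univ i)

lemma MemSH.add {U V : MatFun Θ a a} (hU : MemSH μ U) (hV : MemSH μ V) :
    MemSH μ (fun ℓ => U ℓ + V ℓ) :=
  ⟨hU.1.add hV.1, fun ℓ => by rw [Matrix.transpose_add, hU.2, hV.2]⟩

lemma MemSH.sub {U V : MatFun Θ a a} (hU : MemSH μ U) (hV : MemSH μ V) :
    MemSH μ (fun ℓ => U ℓ - V ℓ) :=
  ⟨hU.1.sub hV.1, fun ℓ => by rw [Matrix.transpose_sub, hU.2, hV.2]⟩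

lemma MemSH.const_smul {U : MatFun Θ a a} (hU : MemSH μ U) (r : ℝ) :
    MemSH μ (fun ℓ => r • U ℓ) :=
  ⟨hU.1.const_smul r, fun ℓ => by rw [Matrix.transpose_smul, hU.2]⟩

lemma memSH_smul_one (r : ℝ) : MemSH μ (fun _ : Θ => r • (1 : Matrix (Fin a) (Fin a) ℝ)) :=
  ⟨memH_const _, fun _ => transpose_smul_one r⟩

lemma memSH_one : MemSH μ (fun _ : Θ => (1 : Matrix (Fin a) (Fin a) ℝ)) := by
  simpa using memSH_smul_one (μ := μ) (a := a) 1

lemma MemSH.conj {U : MatFun Θ a a} {S : MatFun Θ a b} (hU : MemSH μ U) (hS : MemH μ S) :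
    MemSH μ (fun ℓ => (S ℓ)ᵀ * U ℓ * S ℓ) :=
  ⟨(hS.transpose.mul hU.1).mul hS, fun ℓ => by
    simp only [Matrix.transpose_mul, Matrix.transpose_transpose, hU.2, Matrix.mul_assoc]⟩

lemma MemSH.exists_bounds {U : MatFun Θ a a} (hU : MemSH μ U) :
    ∃ r : ℝ, 0 < r ∧ ∀ᵐ ℓ ∂μ, (-r) • 1 ≤ U ℓ ∧ U ℓ ≤ r • 1 := by
  obtain ⟨-, r, hr, b⟩ := memH_iff.1 hU.1
  refine ⟨r * a + 1, by positivity, b.mono fun ℓ h => ⟨?_, ?_⟩⟩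
  · exact (smul_one_mono (by linarith)).trans (neg_smul_one_le_of_abs_entry_le (hU.2 ℓ) h)
  · exact (le_smul_one_of_abs_entry_le (hU.2 ℓ) h).trans (smul_one_mono (by linarith))

lemma abs_entry_le_of_bounds {M L N : Matrix (Fin a) (Fin a) ℝ} (h1 : L ≤ M) (h2 : M ≤ N) {r : ℝ}
    (hL : ∀ i j, |L i j| ≤ r) (hN : ∀ i j, |N i j| ≤ r) (i j : Fin a) : |M i j| ≤ 3 * r := by
  have h3 := abs_entry_le_of_posSemidef (Matrix.le_iff.1 h1) (r := 2 * r) (fun k => by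
    have := entry_self_mono h2 k
    rw [Matrix.sub_apply]
    linarith [abs_le.1 (hL k k), abs_le.1 (hN k k)]) i j
  rw [Matrix.sub_apply] at h3
  have := abs_le.1 (hL i j)
  have := abs_le.1 h3
  rw [abs_le]
  constructor <;> linarith

/-- Functions between two elements of `SH_∞` are uniformly bounded. -/
lemma exists_entry_bound_of_bounds {L N : MatFun Θ a a} (hL : MemSH μ L) (hN : MemSH μ N) :
    ∃ r : ℝ, 0 ≤ r ∧ ∀ᵐ ℓ ∂μ, ∀ M, L ℓ ≤ M → M ≤ N ℓ → ∀ i j, |M i j| ≤ r := by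
  obtain ⟨-, r, hr, bL⟩ := memH_iff.1 hL.1
  obtain ⟨-, s, hs, bN⟩ := memH_iff.1 hN.1
  refine ⟨3 * (r + s), by positivity, ?_⟩
  filter_upwards [bL, bN] with ℓ h1 h2 M hM1 hM2
  exact abs_entry_le_of_bounds hM1 hM2 (fun i j => (h1 i j).trans (by linarith))
    (fun i j => (h2 i j).trans (by linarith))

/-- Order bounds control all entries, because the diagonal of a positive semidefinite matrix does.
Inverses and monotone limits enter `SH_∞` this way. -/
lemma memSH_of_bounds {U L N : MatFun Θ a a} (hL : MemSH μ L) (hN : MemSH μ N)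
    (hm : ∀ i j, Measurable fun ℓ => U ℓ i j) (hs : ∀ ℓ, (U ℓ)ᵀ = U ℓ)
    (h : ∀ᵐ ℓ ∂μ, L ℓ ≤ U ℓ ∧ U ℓ ≤ N ℓ) : MemSH μ U := by
  obtain ⟨r, hr, hb⟩ := exists_entry_bound_of_bounds hL hN
  refine ⟨memH_iff.2 ⟨hm, r, hr, ?_⟩, hs⟩
  filter_upwards [h, hb] with ℓ h1 h2
  exact h2 _ h1.1 h1.2

lemma measurable_det {U : MatFun Θ a a} (hm : ∀ i j, Measurable fun ℓ => U ℓ i j) :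
    Measurable fun ℓ => (U ℓ).det := by
  simp only [Matrix.det_apply']
  exact Finset.measurable_sum _ fun σ _ =>
    (Finset.measurable_prod _ fun i _ => hm _ _).const_mul _

lemma measurable_inv_entry {U : MatFun Θ a a} (hm : ∀ i j, Measurable fun ℓ => U ℓ i j)
    (i j : Fin a) : Measurable fun ℓ => (U ℓ)⁻¹ i j := by
  simp only [Matrix.inv_def, Matrix.smul_apply, smul_eq_mul, Ring.inverse_eq_inv',
    Matrix.adjugate_apply]
  refine (measurable_det hm).inv.mul (measurable_det fun k l => ?_)
  by_cases h : k = j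
  · subst h; simp
  · simpa [Matrix.updateRow_ne h] using hm k l

lemma MemSH.inv {U : MatFun Θ a a} (hU : MemSH μ U) {ξ : ℝ} (hξ : 0 < ξ)
    (h : ∀ᵐ ℓ ∂μ, ξ • 1 ≤ U ℓ) : MemSH μ fun ℓ => (U ℓ)⁻¹ := by
  refine memSH_of_bounds (memSH_smul_one 0) (memSH_smul_one ξ⁻¹) (measurable_inv_entry hU.1.1)
    (fun ℓ => inv_transpose_of_symm (hU.2 ℓ)) ?_
  filter_upwards [h] with ℓ hℓ
  exact ⟨by simpa using inv_nonneg_of_smul_one_le hξ hℓ, inv_le_smul_one hξ hℓ⟩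

end FunctionSpaces

/-! ### The averaging operator `E` and the operators `T_S` -/

/-- Every `𝔾 ℓ` has the density `g ℓ` with respect to `μ`. -/
structure HasTransitionDensity {Θ : Type u} [MeasurableSpace Θ] (μ : Measure Θ) (𝔾 : Kernel Θ Θ)
    (g : Θ → Θ → ℝ) : Prop where
  nonneg : ∀ ℓ t, 0 ≤ g ℓ t
  measurable : ∀ ℓ, Measurable (g ℓ)
  eq_withDensity : ∀ ℓ, 𝔾 ℓ = μ.withDensity fun t => ENNReal.ofReal (g ℓ t)

section Operators

variable {Θ : Type u} [MeasurableSpace Θ] {μ : Measure Θ} {𝔾 : Kernel Θ Θ} {g : Θ → Θ → ℝ}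
  {a b : ℕ}

namespace HasTransitionDensity

lemma absolutelyContinuous (hd : HasTransitionDensity μ 𝔾 g) (ℓ : Θ) : 𝔾 ℓ ≪ μ := by
  rw [hd.eq_withDensity]
  exact withDensity_absolutelyContinuous _ _

/-- Passing to the kernel makes `E(U)` measurable in `ℓ` without joint measurability of `g`. -/
lemma opE_apply (hd : HasTransitionDensity μ 𝔾 g) (U : MatFun Θ a b) (ℓ : Θ) (i : Fin a)
    (j : Fin b) : opE μ g U ℓ i j = ∫ t, U t i j ∂𝔾 ℓ := by
  rw [hd.eq_withDensity, integral_withDensity_eq_integral_toReal_smul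
    (hd.measurable ℓ).ennreal_ofReal (ae_of_all _ fun _ => ENNReal.ofReal_lt_top)]
  simp [opE, ENNReal.toReal_ofReal (hd.nonneg ℓ _)]

variable [IsMarkovKernel 𝔾]

lemma integrable_entry (hd : HasTransitionDensity μ 𝔾 g) {U : MatFun Θ a b} (hU : MemH μ U) (ℓ : Θ)
    (i : Fin a) (j : Fin b) : Integrable (fun t => U t i j) (𝔾 ℓ) := by
  obtain ⟨hm, r, -, hb⟩ := memH_iff.1 hU
  refine Integrable.of_bound (hm i j).aestronglyMeasurable r ?_
  exact (hd.absolutelyContinuous ℓ).ae_le (hb.mono fun t ht => ht i j)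

lemma opE_add (hd : HasTransitionDensity μ 𝔾 g) {U V : MatFun Θ a b} (hU : MemH μ U)
    (hV : MemH μ V) (ℓ : Θ) : opE μ g (fun t => U t + V t) ℓ = opE μ g U ℓ + opE μ g V ℓ := by
  ext i j
  simp only [hd.opE_apply, Matrix.add_apply]
  exact integral_add (hd.integrable_entry hU ℓ i j) (hd.integrable_entry hV ℓ i j)

omit [IsMarkovKernel 𝔾] in
lemma opE_smul (hd : HasTransitionDensity μ 𝔾 g) (U : MatFun Θ a b) (r : ℝ) (ℓ : Θ) :
    opE μ g (fun t => r • U t) ℓ = r • opE μ g U ℓ := by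
  ext i j
  simp only [hd.opE_apply, Matrix.smul_apply, smul_eq_mul]
  exact integral_const_mul _ _

lemma opE_sub (hd : HasTransitionDensity μ 𝔾 g) {U V : MatFun Θ a b} (hU : MemH μ U)
    (hV : MemH μ V) (ℓ : Θ) : opE μ g (fun t => U t - V t) ℓ = opE μ g U ℓ - opE μ g V ℓ := by
  ext i j
  simp only [hd.opE_apply, Matrix.sub_apply]
  exact integral_sub (hd.integrable_entry hU ℓ i j) (hd.integrable_entry hV ℓ i j)

lemma opE_memH (hd : HasTransitionDensity μ 𝔾 g) {U : MatFun Θ a b} (hU : MemH μ U) :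
    MemH μ (opE μ g U) := by
  obtain ⟨hm, r, hr, hb⟩ := memH_iff.1 hU
  refine memH_iff.2 ⟨fun i j => ?_, r, hr, ae_of_all _ fun ℓ i j => ?_⟩
  · simp only [hd.opE_apply]
    exact (hm i j).stronglyMeasurable.integral_kernel.measurable
  · rw [hd.opE_apply]
    have := norm_integral_le_of_norm_le_const (μ := 𝔾 ℓ) (f := fun t => U t i j) (C := r)
      ((hd.absolutelyContinuous ℓ).ae_le (hb.mono fun t ht => ht i j))
    simpa using this

omit [IsMarkovKernel 𝔾] in
lemma opE_transpose (hd : HasTransitionDensity μ 𝔾 g) {U : MatFun Θ a a} (hU : ∀ ℓ, (U ℓ)ᵀ = U ℓ)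
    (ℓ : Θ) : (opE μ g U ℓ)ᵀ = opE μ g U ℓ := by
  ext i j
  rw [Matrix.transpose_apply, hd.opE_apply, hd.opE_apply]
  congr 1
  ext t
  conv_rhs => rw [← hU t, Matrix.transpose_apply]

lemma opE_memSH (hd : HasTransitionDensity μ 𝔾 g) {U : MatFun Θ a a} (hU : MemSH μ U) :
    MemSH μ (opE μ g U) :=
  ⟨hd.opE_memH hU.1, hd.opE_transpose hU.2⟩

lemma integrable_quadForm (hd : HasTransitionDensity μ 𝔾 g) {U : MatFun Θ a a} (hU : MemH μ U)
    (ℓ : Θ) (x : Fin a → ℝ) : Integrable (fun t => x ⬝ᵥ (U t *ᵥ x)) (𝔾 ℓ) := by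
  simp only [quadForm_eq_sum]
  exact integrable_finsetSum _ fun i _ => integrable_finsetSum _ fun j _ =>
    ((hd.integrable_entry hU ℓ i j).mul_const _).const_mul _

lemma quadForm_opE (hd : HasTransitionDensity μ 𝔾 g) {U : MatFun Θ a a} (hU : MemH μ U)
    (ℓ : Θ) (x : Fin a → ℝ) : x ⬝ᵥ (opE μ g U ℓ *ᵥ x) = ∫ t, x ⬝ᵥ (U t *ᵥ x) ∂𝔾 ℓ := by
  simp only [quadForm_eq_sum]
  rw [integral_finsetSum _ fun i _ => integrable_finsetSum _ fun j _ =>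
    ((hd.integrable_entry hU ℓ i j).mul_const _).const_mul _]
  refine Finset.sum_congr rfl fun i _ => ?_
  rw [integral_finsetSum _ fun j _ => ((hd.integrable_entry hU ℓ i j).mul_const _).const_mul _]
  refine Finset.sum_congr rfl fun j _ => ?_
  rw [integral_const_mul, integral_mul_const, hd.opE_apply]

/-- Since `𝔾 ℓ ≪ μ` for each `ℓ`, averaging turns an almost-everywhere inequality into one at every
point. -/
lemma opE_mono (hd : HasTransitionDensity μ 𝔾 g) {U V : MatFun Θ a a} (hU : MemSH μ U)
    (hV : MemSH μ V) (h : ∀ᵐ ℓ ∂μ, U ℓ ≤ V ℓ) (ℓ : Θ) : opE μ g U ℓ ≤ opE μ g V ℓ := by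
  rw [le_iff_quadForm (hd.opE_transpose hU.2 ℓ) (hd.opE_transpose hV.2 ℓ)]
  intro x
  rw [hd.quadForm_opE hU.1, hd.quadForm_opE hV.1]
  exact integral_mono_ae (hd.integrable_quadForm hU.1 ℓ x) (hd.integrable_quadForm hV.1 ℓ x)
    ((hd.absolutelyContinuous ℓ).ae_le (h.mono fun t ht => quadForm_mono ht x))

lemma opE_nonneg (hd : HasTransitionDensity μ 𝔾 g) {U : MatFun Θ a a} (hU : MemSH μ U)
    (h : ∀ᵐ ℓ ∂μ, 0 ≤ U ℓ) (ℓ : Θ) : 0 ≤ opE μ g U ℓ := by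
  have := hd.opE_mono (memSH_smul_one 0) hU (by simpa using h) ℓ
  rw [hd.opE_smul, zero_smul] at this
  exact this

lemma opE_tendsto (hd : HasTransitionDensity μ 𝔾 g) {U : ℕ → MatFun Θ a b} {V : MatFun Θ a b}
    (hm : ∀ k i j, Measurable fun ℓ => U k ℓ i j) {r : ℝ}
    (hb : ∀ k, ∀ᵐ ℓ ∂μ, ∀ i j, |U k ℓ i j| ≤ r)
    (hlim : ∀ᵐ ℓ ∂μ, Tendsto (fun k => U k ℓ) atTop (𝓝 (V ℓ))) (ℓ : Θ) :
    Tendsto (fun k => opE μ g (U k) ℓ) atTop (𝓝 (opE μ g V ℓ)) := by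
  refine tendsto_pi_nhds.2 fun i => tendsto_pi_nhds.2 fun j => ?_
  simp only [hd.opE_apply]
  have hac := (hd.absolutelyContinuous ℓ).ae_le
  refine tendsto_integral_of_dominated_convergence (fun _ => r)
    (fun k => (hm k i j).aestronglyMeasurable) (integrable_const r)
    (fun k => hac ((hb k).mono fun t ht => ht i j)) (hac (hlim.mono fun t ht => ?_))
  exact tendsto_pi_nhds.1 (tendsto_pi_nhds.1 ht i) j

lemma opT_memSH (hd : HasTransitionDensity μ 𝔾 g) {S : MatFun Θ a b} (hS : MemH μ S)
    {U : MatFun Θ a a} (hU : MemSH μ U) : MemSH μ (opT μ g S U) :=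
  (hd.opE_memSH hU).conj hS

lemma opT_mono (hd : HasTransitionDensity μ 𝔾 g) (S : MatFun Θ a b) {U V : MatFun Θ a a}
    (hU : MemSH μ U) (hV : MemSH μ V) (h : ∀ᵐ ℓ ∂μ, U ℓ ≤ V ℓ) (ℓ : Θ) :
    opT μ g S U ℓ ≤ opT μ g S V ℓ :=
  conj_mono (hd.opE_mono hU hV h ℓ) _

lemma opT_nonneg (hd : HasTransitionDensity μ 𝔾 g) (S : MatFun Θ a b) {U : MatFun Θ a a}
    (hU : MemSH μ U) (h : ∀ᵐ ℓ ∂μ, 0 ≤ U ℓ) (ℓ : Θ) : 0 ≤ opT μ g S U ℓ :=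
  conj_nonneg (hd.opE_nonneg hU h ℓ) _

lemma opT_add (hd : HasTransitionDensity μ 𝔾 g) (S : MatFun Θ a b) {U V : MatFun Θ a a}
    (hU : MemSH μ U) (hV : MemSH μ V) (ℓ : Θ) :
    opT μ g S (fun t => U t + V t) ℓ = opT μ g S U ℓ + opT μ g S V ℓ := by
  simp only [opT, hd.opE_add hU.1 hV.1, Matrix.mul_add, Matrix.add_mul]

lemma opT_sub (hd : HasTransitionDensity μ 𝔾 g) (S : MatFun Θ a b) {U V : MatFun Θ a a}
    (hU : MemSH μ U) (hV : MemSH μ V) (ℓ : Θ) :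
    opT μ g S (fun t => U t - V t) ℓ = opT μ g S U ℓ - opT μ g S V ℓ := by
  simp only [opT, hd.opE_sub hU.1 hV.1, Matrix.mul_sub, Matrix.sub_mul]

omit [IsMarkovKernel 𝔾] in
lemma opT_smul (hd : HasTransitionDensity μ 𝔾 g) (S : MatFun Θ a b) (U : MatFun Θ a a) (r : ℝ)
    (ℓ : Θ) : opT μ g S (fun t => r • U t) ℓ = r • opT μ g S U ℓ := by
  simp only [opT, hd.opE_smul, Matrix.mul_smul, Matrix.smul_mul]

end HasTransitionDensity

end Operators

/-! ### Monotone limits in `SH_∞` -/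

section Limits

variable {Θ : Type u} [MeasurableSpace Θ] {μ : Measure Θ} {a b : ℕ}

lemma tendsto_matrix_iff {ι : Type*} {l : Filter ι} {M : ι → Matrix (Fin a) (Fin b) ℝ}
    {N : Matrix (Fin a) (Fin b) ℝ} :
    Tendsto M l (𝓝 N) ↔ ∀ i j, Tendsto (fun k => M k i j) l (𝓝 (N i j)) :=
  ⟨fun h i j => tendsto_pi_nhds.1 (tendsto_pi_nhds.1 h i) j,
    fun h => tendsto_pi_nhds.2 fun i => tendsto_pi_nhds.2 fun j => h i j⟩

lemma tendsto_quadForm {M : ℕ → Matrix (Fin a) (Fin a) ℝ} {N : Matrix (Fin a) (Fin a) ℝ}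
    (h : Tendsto M atTop (𝓝 N)) (x : Fin a → ℝ) :
    Tendsto (fun k => x ⬝ᵥ (M k *ᵥ x)) atTop (𝓝 (x ⬝ᵥ (N *ᵥ x))) := by
  simp only [quadForm_eq_sum]
  exact tendsto_finsetSum _ fun i _ => tendsto_finsetSum _ fun j _ =>
    ((tendsto_matrix_iff.1 h i j).mul_const _).const_mul _

lemma matrix_le_of_tendsto {M N : ℕ → Matrix (Fin a) (Fin a) ℝ} {M' N' : Matrix (Fin a) (Fin a) ℝ}
    (hM : Tendsto M atTop (𝓝 M')) (hN : Tendsto N atTop (𝓝 N')) (h : ∀ k, M k ≤ N k) :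
    M' ≤ N' := by
  have hD := hN.sub hM
  rw [Matrix.le_iff, posSemidef_iff_quadForm]
  refine ⟨?_, fun x => ge_of_tendsto' (tendsto_quadForm hD x) fun k =>
    (posSemidef_iff_quadForm.1 (Matrix.le_iff.1 (h k))).2 x⟩
  ext i j
  refine tendsto_nhds_unique ((tendsto_matrix_iff.1 hD j i)) ?_
  refine (tendsto_matrix_iff.1 hD i j).congr fun k => ?_
  conv_lhs => rw [← transpose_eq_of_posSemidef (Matrix.le_iff.1 (h k)), Matrix.transpose_apply]

/-- Each quadratic form decreases and is bounded below; polarization recovers the entries. -/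
lemma exists_tendsto_of_antitone {M : ℕ → Matrix (Fin a) (Fin a) ℝ} {L : Matrix (Fin a) (Fin a) ℝ}
    (hs : ∀ k, (M k)ᵀ = M k) (hanti : ∀ k, M (k + 1) ≤ M k) (hlb : ∀ k, L ≤ M k) (i j : Fin a) :
    ∃ y, Tendsto (fun k => M k i j) atTop (𝓝 y) := by
  have hq : ∀ x : Fin a → ℝ, ∃ y, Tendsto (fun k => x ⬝ᵥ (M k *ᵥ x)) atTop (𝓝 y) := fun x =>
    ⟨_, tendsto_atTop_ciInf (antitone_nat_of_succ_le fun k => quadForm_mono (hanti k) x)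
      ⟨x ⬝ᵥ (L *ᵥ x), by rintro _ ⟨k, rfl⟩; exact quadForm_mono (hlb k) x⟩⟩
  obtain ⟨y1, h1⟩ := hq (Pi.single i 1 + Pi.single j 1)
  obtain ⟨y2, h2⟩ := hq (Pi.single i 1)
  obtain ⟨y3, h3⟩ := hq (Pi.single j 1)
  refine ⟨(y1 - y2 - y3) / 2, (((h1.sub h2).sub h3).div_const 2).congr fun k => ?_⟩
  rw [← two_mul_entry (hs k)]
  ring

/-- A decreasing sequence in `SH_∞` that is bounded below in `SH_∞` is uniformly bounded and
converges almost everywhere to an element of `SH_∞`. -/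
lemma exists_memSH_tendsto_of_antitone {U : ℕ → MatFun Θ a a} {L : MatFun Θ a a}
    (hU : ∀ k, MemSH μ (U k)) (hL : MemSH μ L) (hanti : ∀ k, ∀ᵐ ℓ ∂μ, U (k + 1) ℓ ≤ U k ℓ)
    (hlb : ∀ k, ∀ᵐ ℓ ∂μ, L ℓ ≤ U k ℓ) :
    ∃ P : MatFun Θ a a, MemSH μ P ∧ (∀ᵐ ℓ ∂μ, Tendsto (fun k => U k ℓ) atTop (𝓝 (P ℓ))) ∧
      ∃ r : ℝ, ∀ k, ∀ᵐ ℓ ∂μ, ∀ i j, |U k ℓ i j| ≤ r := by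
  have hle0 : ∀ᵐ ℓ ∂μ, ∀ k, U k ℓ ≤ U 0 ℓ := by
    filter_upwards [ae_all_iff.2 hanti] with ℓ h k
    exact antitone_nat_of_succ_le (f := fun k => U k ℓ) h (Nat.zero_le k)
  have hlim : ∀ i j, ∃ F : Θ → ℝ, Measurable F ∧
      ∀ᵐ ℓ ∂μ, Tendsto (fun k => U k ℓ i j) atTop (𝓝 (F ℓ)) := by
    intro i j
    refine measurable_limit_of_tendsto_metrizable_ae
      (fun k => ((hU k).1.1 i j).aemeasurable) ?_
    filter_upwards [ae_all_iff.2 hanti, ae_all_iff.2 hlb] with ℓ h1 h2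
    exact exists_tendsto_of_antitone (fun k => (hU k).2 ℓ) h1 h2 i j
  choose F hFm hF using hlim
  -- `F i j` and `F j i` are chosen separately and agree only almost everywhere; averaging restores
  -- symmetry at every point.
  let P : MatFun Θ a a := fun ℓ => Matrix.of fun i j => (F i j ℓ + F j i ℓ) / 2
  have hP : ∀ᵐ ℓ ∂μ, Tendsto (fun k => U k ℓ) atTop (𝓝 (P ℓ)) := by
    filter_upwards [ae_all_iff.2 fun i => ae_all_iff.2 fun j => hF i j] with ℓ h
    refine tendsto_matrix_iff.2 fun i j => (((h i j).add (h j i)).div_const 2).congr fun k => ?_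
    have : U k ℓ j i = U k ℓ i j := by
      conv_lhs => rw [← (hU k).2 ℓ, Matrix.transpose_apply]
    rw [this]
    ring
  refine ⟨P, ?_, hP, ?_⟩
  · refine memSH_of_bounds hL (hU 0) (fun i j => ((hFm i j).add (hFm j i)).div_const 2)
      (fun ℓ => ?_) ?_
    · ext i j
      simp only [P, Matrix.transpose_apply, Matrix.of_apply]
      ring
    · filter_upwards [hP, hle0, ae_all_iff.2 hlb] with ℓ h h0 hl
      exact ⟨matrix_le_of_tendsto tendsto_const_nhds h hl,
        matrix_le_of_tendsto h tendsto_const_nhds h0⟩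
  · obtain ⟨r, -, hr⟩ := exists_entry_bound_of_bounds hL (hU 0)
    refine ⟨r, fun k => ?_⟩
    filter_upwards [hr, hle0, hlb k] with ℓ h h0 hl
    exact h _ hl (h0 k)

end Limits

/-! ### Lyapunov functions -/

/-- The existence of a quadratic Lyapunov function for the closed-loop matrices `A`. -/
def LyapunovStable {Θ : Type u} [MeasurableSpace Θ] (μ : Measure Θ) (g : Θ → Θ → ℝ) {n : ℕ}
    (A : MatFun Θ n n) : Prop :=
  ∃ V : MatFun Θ n n, MemSH μ V ∧ (∀ᵐ ℓ ∂μ, 0 ≤ V ℓ) ∧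
    UnifPos μ (fun ℓ => V ℓ - opT μ g A V ℓ)

section Lyapunov

variable {Θ : Type u} [MeasurableSpace Θ] {μ : Measure Θ} {𝔾 : Kernel Θ Θ} {g : Θ → Θ → ℝ}
  [IsMarkovKernel 𝔾] {n m : ℕ} {A : MatFun Θ n n}

lemma LyapunovStable.exists_contraction (hd : HasTransitionDensity μ 𝔾 g)
    (h : LyapunovStable μ g A) :
    ∃ (V : MatFun Θ n n) (δ ρ : ℝ), MemSH μ V ∧ 0 < δ ∧ 0 < ρ ∧ ρ < 1 ∧
      (∀ᵐ ℓ ∂μ, δ • 1 ≤ V ℓ) ∧ ∀ᵐ ℓ ∂μ, opT μ g A V ℓ ≤ ρ • V ℓ := by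
  obtain ⟨V, hV, hV0, ξ, hξ, hpos⟩ := h
  obtain ⟨r, hr, hb⟩ := hV.exists_bounds
  -- From `V ≤ r + ξ` follows `(ξ / (r + ξ)) V ≤ ξ ≤ V - T_A(V)`. Dividing by `r + ξ` instead of `r`
  -- keeps the rate strictly positive.
  refine ⟨V, ξ, 1 - ξ / (r + ξ), hV, hξ, ?_, ?_, ?_, ?_⟩
  · have : ξ / (r + ξ) < 1 := by rw [div_lt_one (by positivity)]; linarith
    linarith
  · have : 0 < ξ / (r + ξ) := by positivity
    linarith
  · filter_upwards [hpos] with ℓ h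
    exact (Matrix.le_iff.2 h).trans (sub_le_self _ (hd.opT_nonneg A hV hV0 ℓ))
  · filter_upwards [hpos, hb] with ℓ h hb
    have h1 : (ξ / (r + ξ)) • V ℓ ≤ ξ • 1 := by
      have := smul_mono_of_nonneg (hb.2.trans (smul_one_mono (show r ≤ r + ξ by linarith)))
        (show 0 ≤ ξ / (r + ξ) by positivity)
      rwa [smul_smul, div_mul_cancel₀ _ (by positivity)] at this
    have h2 := h1.trans (Matrix.le_iff.2 h)
    rw [sub_smul, one_smul]
    exact le_sub_comm.1 h2

/-- Positivity of the resolvent of `T_A` for stable `A`. -/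
lemma LyapunovStable.nonneg_of_opT_le (hd : HasTransitionDensity μ 𝔾 g)
    (h : LyapunovStable μ g A) {D : MatFun Θ n n} (hD : MemSH μ D)
    (hTD : ∀ᵐ ℓ ∂μ, opT μ g A D ℓ ≤ D ℓ) : ∀ᵐ ℓ ∂μ, 0 ≤ D ℓ := by
  obtain ⟨V, δ, ρ, hV, hδ, hρ0, hρ1, hδV, hTV⟩ := h.exists_contraction hd
  obtain ⟨r, hr, hb⟩ := hD.exists_bounds
  -- The bound `-(r / δ) V ≤ -r ≤ D` starts the induction. Applying `T_A` gains a factor `ρ` on the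
  -- left, while `T_A(D) ≤ D` preserves the right.
  have key : ∀ k : ℕ, ∀ᵐ ℓ ∂μ, (-(r / δ * ρ ^ k)) • V ℓ ≤ D ℓ := by
    intro k
    induction k with
    | zero =>
      filter_upwards [hb, hδV] with ℓ h1 h2
      refine le_trans ?_ h1.1
      have := smul_mono_of_nonneg h2 (show 0 ≤ r / δ by positivity)
      rw [smul_smul, div_mul_cancel₀ _ hδ.ne'] at this
      simpa [neg_smul] using this
    | succ k ih =>
      have h1 := hd.opT_mono A (hV.const_smul _) hD ih
      filter_upwards [hTD, hTV] with ℓ h2 h3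
      refine le_trans ?_ ((h1 ℓ).trans h2)
      rw [hd.opT_smul, neg_smul, neg_smul, neg_le_neg_iff]
      refine (smul_mono_of_nonneg h3 (show 0 ≤ r / δ * ρ ^ k by positivity)).trans (le_of_eq ?_)
      rw [smul_smul]
      ring_nf
  filter_upwards [ae_all_iff.2 key] with ℓ h
  refine matrix_le_of_tendsto (M := fun k => (-(r / δ * ρ ^ k)) • V ℓ) ?_ tendsto_const_nhds h
  have := (((tendsto_pow_atTop_nhds_zero_of_lt_one hρ0.le hρ1).const_mul (r / δ)).neg).smul_const
    (V ℓ)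
  simpa using this

lemma LyapunovStable.ae_eq (hd : HasTransitionDensity μ 𝔾 g)
    (h : LyapunovStable μ g A) {P P' : MatFun Θ n n} (hP : MemSH μ P) (hP' : MemSH μ P')
    (heq : ∀ᵐ ℓ ∂μ, P ℓ - opT μ g A P ℓ = P' ℓ - opT μ g A P' ℓ) : P =ᵐ[μ] P' := by
  have key : ∀ {P P' : MatFun Θ n n}, MemSH μ P → MemSH μ P' →
      (∀ᵐ ℓ ∂μ, P ℓ - opT μ g A P ℓ = P' ℓ - opT μ g A P' ℓ) → ∀ᵐ ℓ ∂μ, P' ℓ ≤ P ℓ := by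
    intro P P' hP hP' heq
    have := h.nonneg_of_opT_le hd (hP.sub hP') (heq.mono fun ℓ hℓ => by
      rw [hd.opT_sub A hP hP']
      refine le_of_eq ?_
      rw [sub_eq_sub_iff_add_eq_add] at hℓ ⊢
      rw [add_comm, ← hℓ, add_comm])
    exact this.mono fun ℓ hℓ => sub_nonneg.1 hℓ
  filter_upwards [key hP hP' heq, key hP' hP (heq.mono fun ℓ => Eq.symm)] with ℓ h1 h2
  exact le_antisymm h2 h1

/-- Iterating `V ↦ T_A(V) + S` from the supersolution `U₀` decreases and stays above the subsolution
`L`. Dominated convergence makes the limit a fixed point. -/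
lemma monotone_iteration_tendsto (hd : HasTransitionDensity μ 𝔾 g) (hA : MemH μ A)
    {S U₀ L : MatFun Θ n n} (hS : MemSH μ S) (hU₀ : MemSH μ U₀) (hL : MemSH μ L)
    (hLU : ∀ᵐ ℓ ∂μ, L ℓ ≤ U₀ ℓ) (hup : ∀ᵐ ℓ ∂μ, opT μ g A U₀ ℓ + S ℓ ≤ U₀ ℓ)
    (hlow : ∀ᵐ ℓ ∂μ, L ℓ ≤ opT μ g A L ℓ + S ℓ) :
    ∃ P : MatFun Θ n n, MemSH μ P ∧ (∀ᵐ ℓ ∂μ, L ℓ ≤ P ℓ) ∧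
      ∀ᵐ ℓ ∂μ, P ℓ - opT μ g A P ℓ = S ℓ := by
  let U : ℕ → MatFun Θ n n := fun k => (fun V ℓ => opT μ g A V ℓ + S ℓ)^[k] U₀
  have hsucc : ∀ k, U (k + 1) = fun ℓ => opT μ g A (U k) ℓ + S ℓ := fun k =>
    Function.iterate_succ_apply' _ _ _
  have hU : ∀ k, MemSH μ (U k) := by
    intro k
    induction k with
    | zero => exact hU₀
    | succ k ih => rw [hsucc]; exact (hd.opT_memSH hA ih).add hS
  have hanti : ∀ k, ∀ᵐ ℓ ∂μ, U (k + 1) ℓ ≤ U k ℓ := by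
    intro k
    induction k with
    | zero => exact hup
    | succ k ih =>
      refine ae_of_all _ fun ℓ => ?_
      rw [hsucc (k + 1)]
      conv_rhs => rw [hsucc k]
      exact add_le_add_left (hd.opT_mono A (hU _) (hU _) ih ℓ) _
  have hlb : ∀ k, ∀ᵐ ℓ ∂μ, L ℓ ≤ U k ℓ := by
    intro k
    induction k with
    | zero => exact hLU
    | succ k ih =>
      filter_upwards [hlow] with ℓ h
      rw [hsucc]
      exact h.trans (add_le_add_left (hd.opT_mono A hL (hU _) ih ℓ) _)
  obtain ⟨P, hP, hlim, r, hr⟩ := exists_memSH_tendsto_of_antitone hU hL hanti hlb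
  refine ⟨P, hP, ?_, ?_⟩
  · filter_upwards [hlim, ae_all_iff.2 hlb] with ℓ h h'
    exact matrix_le_of_tendsto tendsto_const_nhds h h'
  · filter_upwards [hlim] with ℓ h
    have h1 : Tendsto (fun k => U (k + 1) ℓ) atTop (𝓝 (opT μ g A P ℓ + S ℓ)) := by
      simp only [hsucc]
      exact (((tendsto_const_nhds.mul (hd.opE_tendsto (fun k => (hU k).1.1) hr hlim ℓ)).mul
        tendsto_const_nhds)).add_const _
    rw [tendsto_nhds_unique (h.comp (tendsto_add_atTop_nat 1)) h1, add_sub_cancel_left]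

lemma LyapunovStable.exists_solution (hd : HasTransitionDensity μ 𝔾 g)
    (hA : MemH μ A) (h : LyapunovStable μ g A) {S : MatFun Θ n n} (hS : MemSH μ S) :
    ∃ P : MatFun Θ n n, MemSH μ P ∧ ∀ᵐ ℓ ∂μ, P ℓ - opT μ g A P ℓ = S ℓ := by
  obtain ⟨V, hV, hV0, ξ, hξ, hpos⟩ := h
  obtain ⟨r, hr, hb⟩ := hS.exists_bounds
  have hc : 0 ≤ r / ξ := by positivity
  have hrV : ∀ᵐ ℓ ∂μ, r • 1 ≤ (r / ξ) • V ℓ - (r / ξ) • opT μ g A V ℓ := by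
    filter_upwards [hpos] with ℓ h
    have := smul_mono_of_nonneg (Matrix.le_iff.2 h) hc
    rwa [smul_smul, div_mul_cancel₀ _ hξ.ne', smul_sub] at this
  -- As `(r / ξ)(V - T_A(V)) ≥ r` and `-r ≤ S ≤ r`, the functions `±(r / ξ) V` are a super- and a
  -- subsolution.
  refine (monotone_iteration_tendsto hd hA hS (hV.const_smul (r / ξ))
    (hV.const_smul (-(r / ξ))) ?_ ?_ ?_).imp fun P h => ⟨h.1, h.2.2⟩
  · filter_upwards [hV0] with ℓ h
    have := smul_mono_of_nonneg h hc
    rw [smul_zero] at this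
    rw [neg_smul]
    exact (neg_nonpos.2 this).trans this
  · filter_upwards [hb, hrV] with ℓ h1 h2
    rw [hd.opT_smul, ← sub_nonneg]
    convert add_nonneg (sub_nonneg.2 h1.2) (sub_nonneg.2 h2) using 1
    module
  · filter_upwards [hb, hrV] with ℓ h1 h2
    rw [hd.opT_smul, ← sub_nonneg]
    convert add_nonneg (sub_nonneg.2 h1.1) (sub_nonneg.2 h2) using 1
    module

/-- If `F` is stable and the energy of the input `D x` is controlled by a nonnegative function `Y`,
then `F + G D` is stable. -/
lemma LyapunovStable.of_feedback (hd : HasTransitionDensity μ 𝔾 g) {F : MatFun Θ n n}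
    (hFm : MemH μ F) (hF : LyapunovStable μ g F) {G : MatFun Θ n m} (hG : MemH μ G)
    {D : MatFun Θ m n} {Y : MatFun Θ n n} (hY : MemSH μ Y) (hY0 : ∀ᵐ ℓ ∂μ, 0 ≤ Y ℓ)
    {ξ : ℝ} (hξ : 0 < ξ) (hYD : ∀ᵐ ℓ ∂μ,
      ξ • ((D ℓ)ᵀ * D ℓ) ≤ Y ℓ - opT μ g (fun t => F t + G t * D t) Y ℓ) :
    LyapunovStable μ g (fun t => F t + G t * D t) := by
  obtain ⟨Z, hZ, hZeq⟩ := hF.exists_solution hd hFm memSH_one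
  have hZ0 : ∀ᵐ ℓ ∂μ, 0 ≤ Z ℓ := hF.nonneg_of_opT_le hd hZ (hZeq.mono fun ℓ h => by
    rw [← sub_nonneg, h]; exact zero_le_one)
  obtain ⟨z, hz, hzb⟩ := hZ.exists_bounds
  obtain ⟨w, hw, hwb⟩ := (hd.opT_memSH hG hZ).exists_bounds
  -- The Lyapunov function is `Z + cY`, where `Z - T_F(Z) = 1`. Young's inequality costs `εZ ≤ 1/2`
  -- and `(1 + ε⁻¹) w DᵀD`; `c` is chosen so that the decrease of `cY` absorbs the latter.
  set ε : ℝ := (2 * z)⁻¹ with hε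
  have hε0 : 0 < ε := by positivity
  set c : ℝ := (1 + ε⁻¹) * w / ξ with hc
  have hc0 : 0 ≤ c := by positivity
  refine ⟨fun ℓ => Z ℓ + c • Y ℓ, hZ.add (hY.const_smul c), ?_, 1 / 2, by norm_num, ?_⟩
  · filter_upwards [hZ0, hY0] with ℓ h1 h2
    have := smul_mono_of_nonneg h2 hc0
    rw [smul_zero] at this
    exact add_nonneg h1 this
  · filter_upwards [hZeq, hzb, hwb, hYD] with ℓ h1 h2 h3 h4
    rw [← Matrix.le_iff, hd.opT_add _ hZ (hY.const_smul c), hd.opT_smul]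
    have y1 := conj_add_le (hd.opE_nonneg hZ hZ0 ℓ) (F ℓ) (G ℓ * D ℓ) hε0
    have y2 : (F ℓ)ᵀ * opE μ g Z ℓ * F ℓ = Z ℓ - 1 := by
      rw [eq_sub_iff_add_eq, ← h1]; exact add_sub_cancel _ _
    have y3 : (G ℓ * D ℓ)ᵀ * opE μ g Z ℓ * (G ℓ * D ℓ) ≤ w • ((D ℓ)ᵀ * D ℓ) := by
      have := conj_mono h3.2 (D ℓ)
      simpa only [opT, Matrix.transpose_mul, Matrix.mul_assoc, Matrix.smul_mul, Matrix.mul_smul,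
        Matrix.one_mul] using this
    have y4 : ε • Z ℓ ≤ (1 / 2 : ℝ) • 1 := by
      have := smul_mono_of_nonneg h2.2 hε0.le
      rwa [smul_smul, show ε * z = 1 / 2 by rw [hε]; field_simp] at this
    have y5 := smul_mono_of_nonneg y3 (show 0 ≤ 1 + ε⁻¹ by positivity)
    have y6 := smul_mono_of_nonneg h4 hc0
    have y7 : 0 ≤ ε • (1 : Matrix (Fin n) (Fin n) ℝ) := smul_one_nonneg hε0.le
    rw [y2] at y1
    rw [smul_smul, show c * ξ = (1 + ε⁻¹) * w by rw [hc]; field_simp] at y6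
    rw [← sub_nonneg] at y1 y4 y5 y6 ⊢
    have := add_nonneg (add_nonneg (add_nonneg (add_nonneg y1 y4) y5) y6) y7
    convert this using 1
    simp only [opT]
    module

end Lyapunov

/-! ### Mean-square stability and Lyapunov functions -/

section Disintegration

lemma lintegral_of_disintegration {Ω X Θ : Type*} [MeasurableSpace Ω] [MeasurableSpace X]
    [MeasurableSpace Θ] (Pr : Measure Ω) [IsProbabilityMeasure Pr] {H : Ω → X} (hH : Measurable H)
    {Y : Ω → Θ} (hY : Measurable Y) (κ : Kernel X Θ) [IsMarkovKernel κ]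
    (h : ∀ (B : Set X) (Λ : Set Θ), MeasurableSet B → MeasurableSet Λ →
      Pr (H ⁻¹' B ∩ Y ⁻¹' Λ) = ∫⁻ ω in H ⁻¹' B, κ (H ω) Λ ∂Pr)
    {F : X × Θ → ENNReal} (hF : Measurable F) :
    ∫⁻ ω, F (H ω, Y ω) ∂Pr = ∫⁻ ω, ∫⁻ t, F (H ω, t) ∂κ (H ω) ∂Pr := by
  have hPr : IsProbabilityMeasure (Pr.map H) := Measure.isProbabilityMeasure_map hH.aemeasurable
  have key : Pr.map (fun ω => (H ω, Y ω)) = (Pr.map H) ⊗ₘ κ := by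
    have : IsProbabilityMeasure (Pr.map fun ω => (H ω, Y ω)) :=
      Measure.isProbabilityMeasure_map (hH.prodMk hY).aemeasurable
    refine Measure.ext_prod fun {B Λ} hB hΛ => ?_
    rw [Measure.map_apply (hH.prodMk hY) (hB.prod hΛ), Measure.compProd_apply_prod hB hΛ,
      setLIntegral_map hB (κ.measurable_coe hΛ) hH, ← h B Λ hB hΛ]
    rfl
  rw [← lintegral_map (f := F) hF (hH.prodMk hY), key, Measure.lintegral_compProd hF,
    lintegral_map hF.lintegral_kernel_prod_right' hH]

end Disintegration

/-! ### Energy of the state along the Markov chain -/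

section Chain

variable {Θ : Type u} [MeasurableSpace Θ] {μ : Measure Θ} {𝔾 : Kernel Θ Θ} {g : Θ → Θ → ℝ}
  [IsMarkovKernel 𝔾] {n : ℕ} {A : MatFun Θ n n}

lemma measurable_quadForm {X : Type*} [MeasurableSpace X] {s : X → Fin n → ℝ}
    (hs : ∀ i, Measurable fun x => s x i) {M : X → Matrix (Fin n) (Fin n) ℝ}
    (hM : ∀ i j, Measurable fun x => M x i j) :
    Measurable fun x => s x ⬝ᵥ (M x *ᵥ s x) := by
  simp only [quadForm_eq_sum]
  exact Finset.measurable_sum _ fun i _ => Finset.measurable_sum _ fun j _ =>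
    (hs i).mul ((hM i j).mul (hs j))

lemma HasTransitionDensity.lintegral_quadForm (hd : HasTransitionDensity μ 𝔾 g) {U : MatFun Θ n n}
    (hU : MemSH μ U) (hU0 : ∀ᵐ ℓ ∂μ, 0 ≤ U ℓ) (ℓ : Θ) (x : Fin n → ℝ) :
    ∫⁻ t, ENNReal.ofReal (x ⬝ᵥ (U t *ᵥ x)) ∂𝔾 ℓ
      = ENNReal.ofReal (x ⬝ᵥ (opE μ g U ℓ *ᵥ x)) := by
  rw [hd.quadForm_opE hU.1, ofReal_integral_eq_lintegral_ofReal (hd.integrable_quadForm hU.1 ℓ x)]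
  refine (hd.absolutelyContinuous ℓ).ae_le (hU0.mono fun t ht => ?_)
  have := quadForm_mono ht x
  simpa using this

lemma HasTransitionDensity.lintegral_quadForm_step (hd : HasTransitionDensity μ 𝔾 g)
    {U : MatFun Θ n n} (hU : MemSH μ U) (hU0 : ∀ᵐ ℓ ∂μ, 0 ≤ U ℓ) {Ω X : Type*}
    [MeasurableSpace Ω] [MeasurableSpace X] (Pr : Measure Ω) [IsProbabilityMeasure Pr]
    {H : Ω → X} (hH : Measurable H) {Y : Ω → Θ} (hY : Measurable Y) {Z : X → Θ}
    (hZ : Measurable Z)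
    (h : ∀ (B : Set X) (Λ : Set Θ), MeasurableSet B → MeasurableSet Λ →
      Pr (H ⁻¹' B ∩ Y ⁻¹' Λ) = ∫⁻ ω in H ⁻¹' B, 𝔾 (Z (H ω)) Λ ∂Pr)
    {s : X → Fin n → ℝ} (hs : ∀ i, Measurable fun x => s x i) :
    ∫⁻ ω, ENNReal.ofReal (s (H ω) ⬝ᵥ (U (Y ω) *ᵥ s (H ω))) ∂Pr
      = ∫⁻ ω, ENNReal.ofReal (s (H ω) ⬝ᵥ (opE μ g U (Z (H ω)) *ᵥ s (H ω))) ∂Pr := by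
  rw [lintegral_of_disintegration Pr hH hY (𝔾.comap Z hZ) (fun B Λ hB hΛ => h B Λ hB hΛ)
    (F := fun p => ENNReal.ofReal (s p.1 ⬝ᵥ (U p.2 *ᵥ s p.1)))]
  · refine lintegral_congr fun ω => ?_
    rw [Kernel.comap_apply]
    exact hd.lintegral_quadForm hU hU0 (Z (H ω)) (s (H ω))
  · exact (measurable_quadForm (fun i => (hs i).comp measurable_fst)
      fun i j => (hU.1.1 i j).comp measurable_snd).ennreal_ofReal

lemma history_le {Ω : Type u} [MeasurableSpace Ω] {ϑ : ℕ → Ω → Θ} (hϑ : ∀ k, Measurable (ϑ k))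
    (k : ℕ) : history ϑ k ≤ (inferInstance : MeasurableSpace Ω) :=
  iSup_le fun i => (hϑ i).comap_le

lemma measurable_history {Ω : Type u} (ϑ : ℕ → Ω → Θ) {i k : ℕ} (h : i ≤ k) :
    Measurable[history ϑ k] (ϑ i) :=
  measurable_iff_comap_le.2 (le_iSup (fun j : Fin (k + 1) =>
    MeasurableSpace.comap (ϑ j) inferInstance) ⟨i, Nat.lt_succ_of_le h⟩)

lemma history_mono {Ω : Type u} (ϑ : ℕ → Ω → Θ) {k l : ℕ} (h : k ≤ l) :
    history ϑ k ≤ history ϑ l :=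
  iSup_le fun i => measurable_iff_comap_le.1
    (measurable_history ϑ ((Nat.le_of_lt_succ i.2).trans h))

/-- The state at time `k + 1` involves the chain only up to time `k`, so it can be frozen when
conditioning `ϑ (k + 1)` on the history. -/
lemma measurable_state_succ {Ω : Type u} (ϑ : ℕ → Ω → Θ)
    (hA : ∀ i j, Measurable fun ℓ => A ℓ i j) (x₀ : EuclideanSpace ℝ (Fin n)) (k : ℕ) (i : Fin n) :
    Measurable[history ϑ k] fun ω => (state A (fun l => ϑ l ω) x₀ (k + 1)).ofLp i := by
  induction k generalizing i with
  | zero =>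
    simp only [state, Matrix.mulVec, dotProduct]
    exact Finset.measurable_sum _ fun j _ =>
      ((hA i j).comp (measurable_history ϑ le_rfl)).mul_const _
  | succ k ih =>
    have : (fun ω => (state A (fun l => ϑ l ω) x₀ (k + 1 + 1)).ofLp i) = fun ω =>
        ∑ j, A (ϑ (k + 1) ω) i j * (state A (fun l => ϑ l ω) x₀ (k + 1)).ofLp j := rfl
    rw [this]
    exact Finset.measurable_sum _ fun j _ =>
      ((hA i j).comp (measurable_history ϑ le_rfl)).mul
        ((ih j).mono (history_mono ϑ (Nat.le_succ k)) le_rfl)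

/-- There is a chain with transition kernel `𝔾` and any given initial distribution. -/
lemma exists_isMarkovChain (𝔾 : Kernel Θ Θ) [IsMarkovKernel 𝔾] (ν : Measure Θ)
    [IsProbabilityMeasure ν] : ∃ Pr : Measure (ℕ → Θ), IsProbabilityMeasure Pr ∧
      IsMarkovChain 𝔾 Pr (fun k ω => ω k) ∧ Pr.map (fun ω => ω 0) = ν := by
  let κ : (k : ℕ) → Kernel ((i : Finset.Iic k) → Θ) Θ := fun k =>
    𝔾.comap (fun y => y ⟨k, Finset.mem_Iic.2 le_rfl⟩) (measurable_pi_apply _)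
  let Pr : Measure (ℕ → Θ) := Kernel.trajMeasure (X := fun _ => Θ) ν κ
  have hmk : ∀ k, IsMarkovKernel (κ k) := fun k => by dsimp only [κ]; infer_instance
  have hPr : IsProbabilityMeasure Pr := by dsimp only [Pr]; infer_instance
  refine ⟨Pr, hPr, ⟨fun k => measurable_pi_apply k, fun k Λ hΛ => ?_⟩, ?_⟩
  · have hm : history (fun k (ω : ℕ → Θ) => ω k) k ≤ MeasurableSpace.pi :=
      history_le (fun k => measurable_pi_apply k) k
    have hle : history (fun k (ω : ℕ → Θ) => ω k) k
        ≤ MeasurableSpace.comap (Preorder.frestrictLe (π := fun _ => Θ) k) inferInstance := by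
      refine iSup_le fun i => ?_
      have hi : (i : ℕ) ∈ Finset.Iic k := Finset.mem_Iic.2 (Nat.le_of_lt_succ i.2)
      rintro _ ⟨B, hB, rfl⟩
      exact ⟨(fun y : (i : Finset.Iic k) → Θ => y ⟨i, hi⟩) ⁻¹' B, measurable_pi_apply _ hB, rfl⟩
    have hmeas : Measurable[history (fun k (ω : ℕ → Θ) => ω k) k]
        fun ω : ℕ → Θ => (𝔾 (ω k)).real Λ :=
      ((𝔾.measurable_coe hΛ).ennreal_toReal).comp
        (measurable_history (fun k (ω : ℕ → Θ) => ω k) le_rfl)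
    have hint : Integrable (fun ω : ℕ → Θ => (𝔾 (ω k)).real Λ) Pr := by
      refine Integrable.of_bound (hmeas.mono hm le_rfl).aestronglyMeasurable 1
        (ae_of_all _ fun ω => ?_)
      rw [Real.norm_of_nonneg measureReal_nonneg]
      exact measureReal_le_one
    have hS : MeasurableSet ((fun ω : ℕ → Θ => ω (k + 1)) ⁻¹' Λ) := measurable_pi_apply _ hΛ
    refine (ae_eq_condExp_of_forall_setIntegral_eq hm ((integrable_const (1 : ℝ)).indicator hS)
      (fun B _ _ => hint.integrableOn) (fun B hB _ => ?_) hmeas.aestronglyMeasurable).symm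
    obtain ⟨B', hB', rfl⟩ := hle B hB
    rw [setIntegral_indicator hS, setIntegral_const, smul_eq_mul, mul_one]
    have hfr : Measurable (Preorder.frestrictLe (π := fun _ => Θ) k) := by fun_prop
    -- The joint law of the first coordinates and the next one gives the set integrals that
    -- characterize the conditional expectation.
    have hpair := Kernel.map_frestrictLe_trajMeasure_compProd_eq_map_trajMeasure
      (X := fun _ => Θ) (κ := κ) (μ₀ := ν) (a := k)
    have := congrArg (fun m => m (B' ×ˢ Λ)) hpair
    have hP : IsProbabilityMeasure (Pr.map (Preorder.frestrictLe (π := fun _ => Θ) k)) :=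
      Measure.isProbabilityMeasure_map hfr.aemeasurable
    rw [Measure.compProd_apply_prod hB' hΛ, setLIntegral_map hB' ((κ k).measurable_coe hΛ) hfr,
      Measure.map_apply (hfr.prodMk (measurable_pi_apply _)) (hB'.prod hΛ)] at this
    have hk : Measurable fun ω : ℕ → Θ => 𝔾 (ω k) Λ :=
      (𝔾.measurable_coe hΛ).comp (measurable_pi_apply k)
    simp only [Measure.real]
    rw [integral_toReal hk.aemeasurable
      (ae_of_all _ fun ω => measure_lt_top _ _)]
    congr 1
  · have h1 : Pr.map (Preorder.frestrictLe (π := fun _ => Θ) 0)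
        = ν.map (MeasurableEquiv.piUnique (fun _ : Finset.Iic 0 => Θ)).symm := by
      dsimp only [Pr]
      rw [Kernel.trajMeasure, Measure.map_comp _ _ (by fun_prop), Kernel.traj_map_frestrictLe,
        Kernel.partialTraj_self]
      exact Measure.id_comp
    have h2 := congrArg (Measure.map fun y : (i : Finset.Iic 0) → Θ =>
      y ⟨0, Finset.mem_Iic.2 le_rfl⟩) h1
    rw [Measure.map_map (measurable_pi_apply _) (by fun_prop),
      Measure.map_map (measurable_pi_apply _) (by fun_prop)] at h2
    refine h2.trans ?_
    exact Measure.map_id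

variable {Ω : Type u} [MeasurableSpace Ω] {Pr : Measure Ω} {ϑ : ℕ → Ω → Θ}

/-- The expectation of `x(k)ᵀ U(ϑ(k)) x(k)`. -/
def quadEnergy (Pr : Measure Ω) (ϑ : ℕ → Ω → Θ) (A : MatFun Θ n n)
    (x₀ : EuclideanSpace ℝ (Fin n)) (k : ℕ) (U : MatFun Θ n n) : ENNReal :=
  ∫⁻ ω, ENNReal.ofReal ((state A (fun i => ϑ i ω) x₀ k).ofLp ⬝ᵥ
    (U (ϑ k ω) *ᵥ (state A (fun i => ϑ i ω) x₀ k).ofLp)) ∂Pr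

omit [MeasurableSpace Θ] in
lemma quadEnergy_smul {r : ℝ} (hr : 0 ≤ r) (x₀ : EuclideanSpace ℝ (Fin n)) (k : ℕ)
    (U : MatFun Θ n n) :
    quadEnergy Pr ϑ A x₀ k (fun ℓ => r • U ℓ) = ENNReal.ofReal r * quadEnergy Pr ϑ A x₀ k U := by
  rw [quadEnergy, quadEnergy, ← lintegral_const_mul' _ _ ENNReal.ofReal_ne_top]
  refine lintegral_congr fun ω => ?_
  rw [← ENNReal.ofReal_mul hr, Matrix.smul_mulVec, dotProduct_smul, smul_eq_mul]

lemma norm_sq_eq_dotProduct (x : EuclideanSpace ℝ (Fin n)) : ‖x‖ ^ 2 = x.ofLp ⬝ᵥ x.ofLp := by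
  rw [EuclideanSpace.real_norm_sq_eq]
  simp [dotProduct, pow_two]

omit [MeasurableSpace Θ] in
lemma quadEnergy_one (x₀ : EuclideanSpace ℝ (Fin n)) (k : ℕ) :
    quadEnergy Pr ϑ A x₀ k (fun _ => 1)
      = ∫⁻ ω, ENNReal.ofReal (‖state A (fun i => ϑ i ω) x₀ k‖ ^ 2) ∂Pr := by
  simp [quadEnergy, norm_sq_eq_dotProduct]

variable [IsProbabilityMeasure Pr]

lemma IsMarkovChain.measure_inter (hϑ : IsMarkovChain 𝔾 Pr ϑ) (k : ℕ) {B : Set Ω} {Λ : Set Θ}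
    (hB : MeasurableSet[history ϑ k] B) (hΛ : MeasurableSet Λ) :
    Pr (B ∩ ϑ (k + 1) ⁻¹' Λ) = ∫⁻ ω in B, 𝔾 (ϑ k ω) Λ ∂Pr := by
  have hm := history_le hϑ.measurable k
  have hS : MeasurableSet (ϑ (k + 1) ⁻¹' Λ) := hϑ.measurable _ hΛ
  have h1 := setIntegral_condExp hm ((integrable_const (1 : ℝ)).indicator hS) hB (μ := Pr)
  rw [setIntegral_congr_ae (hm _ hB) ((hϑ.markov k Λ hΛ).mono fun ω h _ => h),
    setIntegral_indicator hS, setIntegral_const, smul_eq_mul, mul_one] at h1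
  have hmeas : Measurable fun ω => 𝔾 (ϑ k ω) Λ := (𝔾.measurable_coe hΛ).comp (hϑ.measurable k)
  simp only [Measure.real] at h1
  rw [integral_toReal hmeas.aemeasurable (ae_of_all _ fun ω => measure_lt_top _ _)] at h1
  refine ((ENNReal.toReal_eq_toReal_iff' ?_ (measure_ne_top _ _)).1 h1).symm
  refine ((lintegral_mono fun ω => prob_le_one).trans_lt ?_).ne
  simp

/-- This lets `μ`-almost-everywhere inequalities be evaluated along the chain at every time. -/
lemma IsMarkovChain.map_absolutelyContinuous (hd : HasTransitionDensity μ 𝔾 g)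
    (hϑ : IsMarkovChain 𝔾 Pr ϑ) (h0 : Pr.map (ϑ 0) ≪ μ) (k : ℕ) : Pr.map (ϑ k) ≪ μ := by
  cases k with
  | zero => exact h0
  | succ k =>
    refine Measure.AbsolutelyContinuous.mk fun Λ hΛ hμ => ?_
    have := hϑ.measure_inter k (B := Set.univ) MeasurableSet.univ hΛ
    rw [Measure.map_apply (hϑ.measurable _) hΛ, ← Set.univ_inter (ϑ (k + 1) ⁻¹' Λ), this]
    simp [hd.absolutelyContinuous _ hμ]

lemma quadEnergy_succ (hd : HasTransitionDensity μ 𝔾 g) (hϑ : IsMarkovChain 𝔾 Pr ϑ)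
    (hA : MemH μ A) (x₀ : EuclideanSpace ℝ (Fin n)) (k : ℕ) {U : MatFun Θ n n} (hU : MemSH μ U)
    (hU0 : ∀ᵐ ℓ ∂μ, 0 ≤ U ℓ) :
    quadEnergy Pr ϑ A x₀ (k + 1) U = quadEnergy Pr ϑ A x₀ k (opT μ g A U) := by
  -- The conditioning variable is the identity from `Ω` to `Ω` with the history `σ`-algebra, which
  -- encodes the whole past.
  have h := @HasTransitionDensity.lintegral_quadForm_step Θ _ μ 𝔾 g _ n hd U hU hU0 Ω Ω _
    (history ϑ k) Pr _ id (measurable_id.mono (history_le hϑ.measurable k) le_rfl) (ϑ (k + 1))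
    (hϑ.measurable _) (ϑ k) (measurable_history ϑ le_rfl)
    (fun B Λ hB hΛ => hϑ.measure_inter k hB hΛ)
    (fun ω => (state A (fun i => ϑ i ω) x₀ (k + 1)).ofLp) (measurable_state_succ ϑ hA.1 x₀ k)
  refine h.trans (lintegral_congr fun ω => ?_)
  simp only [id, state, opT, quadForm_conj]

lemma quadEnergy_mono (hd : HasTransitionDensity μ 𝔾 g) (hϑ : IsMarkovChain 𝔾 Pr ϑ)
    (h0 : Pr.map (ϑ 0) ≪ μ) (x₀ : EuclideanSpace ℝ (Fin n)) (k : ℕ) {U V : MatFun Θ n n}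
    (h : ∀ᵐ ℓ ∂μ, U ℓ ≤ V ℓ) : quadEnergy Pr ϑ A x₀ k U ≤ quadEnergy Pr ϑ A x₀ k V := by
  refine lintegral_mono_ae ?_
  filter_upwards [ae_of_ae_map (hϑ.measurable k).aemeasurable
    ((hϑ.map_absolutelyContinuous hd h0 k).ae_le h)] with ω hω
  exact ENNReal.ofReal_le_ofReal (quadForm_mono hω _)

/-- The energy weighted by `V` shrinks by the factor `ρ` at each step, and `δ ≤ V ≤ r` compares it
with the squared norm. -/
theorem LyapunovStable.emss (hd : HasTransitionDensity μ 𝔾 g) (hA : MemH μ A)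
    (h : LyapunovStable μ g A) : EMSS μ 𝔾 A := by
  obtain ⟨V, δ, ρ, hV, hδ, hρ0, hρ1, hδV, hTV⟩ := h.exists_contraction hd
  obtain ⟨r, hr, hb⟩ := hV.exists_bounds
  have hV0 : ∀ᵐ ℓ ∂μ, 0 ≤ V ℓ := hδV.mono fun ℓ h => (smul_one_nonneg hδ.le).trans h
  refine ⟨1 + r / δ, ρ, by have : 0 < r / δ := by positivity
                           linarith, hρ0, hρ1, ?_⟩
  intro Ω _ Pr _ ϑ hϑ h0 x₀ k
  have hdecay : ∀ k, quadEnergy Pr ϑ A x₀ k V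
      ≤ ENNReal.ofReal (ρ ^ k) * quadEnergy Pr ϑ A x₀ 0 V := by
    intro k
    induction k with
    | zero => simp
    | succ k ih =>
      rw [quadEnergy_succ hd hϑ hA x₀ k hV hV0]
      refine (quadEnergy_mono hd hϑ h0 x₀ k hTV).trans ?_
      rw [quadEnergy_smul hρ0.le, pow_succ', ENNReal.ofReal_mul hρ0.le, mul_assoc]
      gcongr
  have hinit : quadEnergy Pr ϑ A x₀ 0 V ≤ ENNReal.ofReal (r * ‖x₀‖ ^ 2) := by
    refine (quadEnergy_mono (V := fun _ => r • 1) hd hϑ h0 x₀ 0 (hb.mono fun ℓ h => h.2)).trans ?_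
    rw [quadEnergy_smul hr.le, quadEnergy_one, ENNReal.ofReal_mul hr.le]
    simp [state]
  rw [← quadEnergy_one]
  have h1 : quadEnergy Pr ϑ A x₀ k (fun _ => 1)
      ≤ ENNReal.ofReal δ⁻¹ * quadEnergy Pr ϑ A x₀ k V := by
    rw [← quadEnergy_smul (inv_nonneg.2 hδ.le)]
    refine quadEnergy_mono hd hϑ h0 x₀ k (hδV.mono fun ℓ h => ?_)
    have := smul_mono_of_nonneg h (inv_nonneg.2 hδ.le)
    rwa [smul_smul, inv_mul_cancel₀ hδ.ne', one_smul] at this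
  calc _ ≤ ENNReal.ofReal δ⁻¹ * (ENNReal.ofReal (ρ ^ k) * ENNReal.ofReal (r * ‖x₀‖ ^ 2)) :=
        h1.trans (by gcongr; exact (hdecay k).trans (by gcongr))
    _ = ENNReal.ofReal (r / δ * ρ ^ k * ‖x₀‖ ^ 2) := by
        rw [← ENNReal.ofReal_mul (by positivity), ← ENNReal.ofReal_mul (by positivity)]
        congr 1
        ring
    _ ≤ _ := by
        refine ENNReal.ofReal_le_ofReal ?_
        gcongr
        linarith

/-- Starting the chain from `μ` conditioned on a set `s` and the state at a basis vector, stability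
bounds the mean of a diagonal entry of `T_A^k(1)` over `s`. Since `s` is arbitrary and the constants
do not depend on it, the bound holds almost everywhere; positivity extends it from the diagonal to
the matrix at the cost of a factor `n`. -/
lemma EMSS.exists_iterate_bound [SigmaFinite μ] (hd : HasTransitionDensity μ 𝔾 g) (hA : MemH μ A)
    (h : EMSS μ 𝔾 A) : ∃ β α : ℝ, 0 ≤ β ∧ 0 < α ∧ α < 1 ∧ ∀ k : ℕ,
      MemSH μ ((opT μ g A)^[k] fun _ => 1) ∧
      (∀ᵐ ℓ ∂μ, 0 ≤ ((opT μ g A)^[k] fun _ => 1) ℓ) ∧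
      ∀ᵐ ℓ ∂μ, ((opT μ g A)^[k] fun _ => 1) ℓ ≤ (β * α ^ k) • 1 := by
  obtain ⟨β, α, hβ, hα0, hα1, h⟩ := h
  have hT : ∀ (k : ℕ) (U : MatFun Θ n n), MemSH μ U → (∀ᵐ ℓ ∂μ, 0 ≤ U ℓ) →
      MemSH μ ((opT μ g A)^[k] U) ∧ ∀ᵐ ℓ ∂μ, 0 ≤ ((opT μ g A)^[k] U) ℓ := by
    intro k
    induction k with
    | zero => exact fun U h1 h2 => ⟨h1, h2⟩
    | succ k ih =>
      intro U h1 h2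
      rw [Function.iterate_succ_apply]
      exact ih _ (hd.opT_memSH hA h1) (ae_of_all _ (hd.opT_nonneg A h1 h2))
  have hone : ∀ᵐ ℓ ∂μ, 0 ≤ (1 : Matrix (Fin n) (Fin n) ℝ) := ae_of_all _ fun _ => zero_le_one
  refine ⟨β * n, α, by positivity, hα0, hα1, fun k => ?_⟩
  obtain ⟨hmem, hnn⟩ := hT k _ memSH_one hone
  refine ⟨hmem, hnn, ?_⟩
  set W := (opT μ g A)^[k] fun _ => 1 with hW
  have hdiag : ∀ i : Fin n, ∀ᵐ ℓ ∂μ, W ℓ i i ≤ β * α ^ k := by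
    intro i
    have hle : (fun ℓ => ENNReal.ofReal (W ℓ i i)) ≤ᵐ[μ]
        fun _ => ENNReal.ofReal (β * α ^ k) := by
      refine ae_le_of_forall_setLIntegral_le_of_sigmaFinite (hmem.1.1 i i).ennreal_ofReal
        fun s hs hsfin => ?_
      rcases eq_or_ne (μ s) 0 with hs0 | hs0
      · simp [Measure.restrict_eq_zero.2 hs0]
      have hν : IsProbabilityMeasure (μ[|s]) := cond_isProbabilityMeasure_of_finite hs0 hsfin.ne
      obtain ⟨Pr, hPr, hchain, hinit⟩ := exists_isMarkovChain 𝔾 (μ[|s])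
      have hac : Pr.map (fun ω => ω 0) ≪ μ := by rw [hinit]; exact cond_absolutelyContinuous
      let x₀ : EuclideanSpace ℝ (Fin n) := EuclideanSpace.single i 1
      have hpull : ∀ (k : ℕ) (U : MatFun Θ n n), MemSH μ U → (∀ᵐ ℓ ∂μ, 0 ≤ U ℓ) →
          quadEnergy Pr (fun k ω => ω k) A x₀ k U
            = quadEnergy Pr (fun k ω => ω k) A x₀ 0 ((opT μ g A)^[k] U) := by
        intro k
        induction k with
        | zero => exact fun U _ _ => rfl
        | succ k ih =>
          intro U h1 h2
          rw [quadEnergy_succ hd hchain hA x₀ k h1 h2, Function.iterate_succ_apply]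
          exact ih _ (hd.opT_memSH hA h1) (ae_of_all _ (hd.opT_nonneg A h1 h2))
      have h1 := h (ℕ → Θ) Pr _ hchain hac x₀ k
      rw [← quadEnergy_one, hpull k _ memSH_one hone, ← hW] at h1
      have h2 : quadEnergy Pr (fun k ω => ω k) A x₀ 0 W
          = ∫⁻ ℓ, ENNReal.ofReal (W ℓ i i) ∂(μ[|s]) := by
        rw [← hinit, lintegral_map (hmem.1.1 i i).ennreal_ofReal (measurable_pi_apply 0)]
        refine lintegral_congr fun ω => ?_
        simp [state, x₀]
      rw [h2, ProbabilityTheory.cond, lintegral_smul_measure, smul_eq_mul] at h1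
      simp only [x₀, PiLp.norm_single, norm_one, one_pow, mul_one] at h1
      rw [setLIntegral_const, mul_comm]
      rwa [ENNReal.inv_mul_le_iff hs0 hsfin.ne] at h1
    exact hle.mono fun ℓ hℓ => (ENNReal.ofReal_le_ofReal_iff (by positivity)).1 hℓ
  filter_upwards [hnn, ae_all_iff.2 hdiag] with ℓ h0 h1
  have h2 := abs_entry_le_of_posSemidef (Matrix.nonneg_iff_posSemidef.1 h0) h1
  refine (le_smul_one_of_abs_entry_le (hmem.2 ℓ) h2).trans (le_of_eq ?_)
  congr 1
  ring

/-- The partial sum `V = ∑_{j<N} T_A^j(1)` telescopes to `V - T_A(V) = 1 - T_A^N(1)`. One `N` with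
`T_A^N(1) ≤ 1/2` suffices, so no infinite series is needed. -/
theorem EMSS.lyapunovStable [SigmaFinite μ] (hd : HasTransitionDensity μ 𝔾 g) (hA : MemH μ A)
    (h : EMSS μ 𝔾 A) : LyapunovStable μ g A := by
  obtain ⟨β, α, hβ, hα0, hα1, hk⟩ := h.exists_iterate_bound hd hA
  have hsum : ∀ N : ℕ, ∃ V : MatFun Θ n n, MemSH μ V ∧ (∀ᵐ ℓ ∂μ, 0 ≤ V ℓ) ∧
      ∀ ℓ, V ℓ - opT μ g A V ℓ = 1 - ((opT μ g A)^[N] fun _ => 1) ℓ := by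
    intro N
    induction N with
    | zero =>
      refine ⟨fun _ => (0 : ℝ) • 1, memSH_smul_one 0, ae_of_all _ fun ℓ => by simp, fun ℓ => ?_⟩
      rw [hd.opT_smul]
      simp
    | succ N ih =>
      obtain ⟨V, hV, hV0, hVeq⟩ := ih
      obtain ⟨h1, h2, -⟩ := hk N
      refine ⟨fun ℓ => V ℓ + ((opT μ g A)^[N] fun _ => 1) ℓ, hV.add h1, ?_, fun ℓ => ?_⟩
      · filter_upwards [hV0, h2] with ℓ using add_nonneg
      · rw [hd.opT_add A hV h1, add_sub_add_comm, hVeq, Function.iterate_succ_apply']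
        abel
  have hlim : Tendsto (fun k : ℕ => β * α ^ k) atTop (𝓝 0) := by
    simpa using (tendsto_pow_atTop_nhds_zero_of_lt_one hα0.le hα1).const_mul β
  obtain ⟨N, hN⟩ := (hlim.eventually (gt_mem_nhds (show (0 : ℝ) < 1 / 2 by norm_num))).exists
  obtain ⟨V, hV, hV0, hVeq⟩ := hsum N
  refine ⟨V, hV, hV0, 1 / 2, by norm_num, ?_⟩
  filter_upwards [(hk N).2.2] with ℓ hℓ
  rw [hVeq, ← Matrix.le_iff, le_sub_comm]
  refine (hℓ.trans (smul_one_mono hN.le)).trans (le_of_eq ?_)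
  module

theorem emss_iff_lyapunovStable [SigmaFinite μ] (hd : HasTransitionDensity μ 𝔾 g)
    (hA : MemH μ A) : EMSS μ 𝔾 A ↔ LyapunovStable μ g A :=
  ⟨fun h => h.lyapunovStable hd hA, fun h => h.emss hd hA⟩

end Chain

/-! ### The Kleinman iteration -/

section RiccatiAlgebra

variable {n m : ℕ}

/-- The left side is quadratic in `K` with leading coefficient `R + GᵀXG`; expanding around its
stationary point leaves the Riccati expression as constant term. -/
lemma completion_of_squares (A X : Matrix (Fin n) (Fin n) ℝ) (G : Matrix (Fin n) (Fin m) ℝ)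
    (K : Matrix (Fin m) (Fin n) ℝ) (R : Matrix (Fin m) (Fin m) ℝ) (hX : Xᵀ = X) (hR : Rᵀ = R)
    (hdet : IsUnit (R + Gᵀ * X * G).det) :
    (A + G * K)ᵀ * X * (A + G * K) + Kᵀ * R * K =
      Aᵀ * X * A - (Gᵀ * X * A)ᵀ * (R + Gᵀ * X * G)⁻¹ * (Gᵀ * X * A) +
        (K - -((R + Gᵀ * X * G)⁻¹ * (Gᵀ * X * A)))ᵀ * (R + Gᵀ * X * G) *
          (K - -((R + Gᵀ * X * G)⁻¹ * (Gᵀ * X * A))) := by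
  have hRp : (R + Gᵀ * X * G)ᵀ = R + Gᵀ * X * G := by
    simp only [Matrix.transpose_add, Matrix.transpose_mul, Matrix.transpose_transpose, hX, hR,
      Matrix.mul_assoc]
  have hinv := inv_transpose_of_symm hRp
  have hC : (Gᵀ * X * A)ᵀ = Aᵀ * X * G := by
    simp only [Matrix.transpose_mul, Matrix.transpose_transpose, hX, Matrix.mul_assoc]
  have h1 : (R + Gᵀ * X * G) * ((R + Gᵀ * X * G)⁻¹ * (Gᵀ * X * A)) = Gᵀ * X * A :=
    Matrix.mul_nonsing_inv_cancel_left _ _ hdet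
  have h2 : (Aᵀ * X * G) * (R + Gᵀ * X * G)⁻¹ * (R + Gᵀ * X * G) = Aᵀ * X * G :=
    Matrix.nonsing_inv_mul_cancel_right _ _ hdet
  rw [sub_neg_eq_add]
  simp only [Matrix.transpose_add, Matrix.transpose_mul (R + Gᵀ * X * G)⁻¹, hinv, hC]
  rw [Matrix.add_mul _ _ (R + Gᵀ * X * G), h2, Matrix.mul_add (Kᵀ * (R + Gᵀ * X * G) + _) K,
    Matrix.add_mul _ _ ((R + Gᵀ * X * G)⁻¹ * (Gᵀ * X * A)),
    Matrix.mul_assoc Kᵀ (R + Gᵀ * X * G) ((R + Gᵀ * X * G)⁻¹ * (Gᵀ * X * A)), h1]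
  simp only [Matrix.transpose_mul, Matrix.add_mul, Matrix.mul_add, Matrix.mul_assoc]
  abel

lemma tendsto_matrix_mul {a b c : ℕ} {M : ℕ → Matrix (Fin a) (Fin b) ℝ}
    {N : ℕ → Matrix (Fin b) (Fin c) ℝ} {M' : Matrix (Fin a) (Fin b) ℝ}
    {N' : Matrix (Fin b) (Fin c) ℝ} (hM : Tendsto M atTop (𝓝 M')) (hN : Tendsto N atTop (𝓝 N')) :
    Tendsto (fun k => M k * N k) atTop (𝓝 (M' * N')) :=
  ((continuous_fst.matrix_mul continuous_snd).tendsto (M', N')).comp (hM.prodMk_nhds hN)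

lemma tendsto_matrix_transpose {a b : ℕ} {M : ℕ → Matrix (Fin a) (Fin b) ℝ}
    {M' : Matrix (Fin a) (Fin b) ℝ} (hM : Tendsto M atTop (𝓝 M')) :
    Tendsto (fun k => (M k)ᵀ) atTop (𝓝 M'ᵀ) :=
  (continuous_id.matrix_transpose.tendsto M').comp hM

lemma tendsto_matrix_inv {M : ℕ → Matrix (Fin m) (Fin m) ℝ} {N : Matrix (Fin m) (Fin m) ℝ}
    (h : Tendsto M atTop (𝓝 N)) (hN : IsUnit N.det) :
    Tendsto (fun k => (M k)⁻¹) atTop (𝓝 N⁻¹) := by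
  simp only [Matrix.inv_def, Ring.inverse_eq_inv']
  exact (((continuous_id.matrix_det.tendsto N).comp h).inv₀ hN.ne_zero).smul
    ((continuous_id.matrix_adjugate.tendsto N).comp h)

end RiccatiAlgebra

/-! ### Order properties of one iteration step -/

section Riccati

variable {Θ : Type u} [MeasurableSpace Θ] {μ : Measure Θ} {𝔾 : Kernel Θ Θ} {g : Θ → Θ → ℝ}
  [IsMarkovKernel 𝔾] {n m : ℕ} {A : MatFun Θ n n} {G : MatFun Θ n m} {Q : MatFun Θ n n}
  {R : MatFun Θ m m}

lemma opR_memSH (hd : HasTransitionDensity μ 𝔾 g) (hG : MemH μ G) (hR : MemSH μ R)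
    {P : MatFun Θ n n} (hP : MemSH μ P) : MemSH μ (opR μ g G R P) :=
  hR.add (hd.opT_memSH hG hP)

lemma opM_memH (hd : HasTransitionDensity μ 𝔾 g) (hA : MemH μ A) (hG : MemH μ G) (hR : MemSH μ R)
    {P : MatFun Θ n n} (hP : MemSH μ P) (hpos : UnifPos μ (opR μ g G R P)) :
    MemH μ (opM μ g A G R P) := by
  obtain ⟨ξ, hξ, h⟩ := hpos
  exact (((opR_memSH hd hG hR hP).inv hξ h).1.mul
    ((hG.transpose.mul (hd.opE_memH hP.1)).mul hA)).neg

lemma UnifPos.opR_mono (hd : HasTransitionDensity μ 𝔾 g) {P P' : MatFun Θ n n} (hP : MemSH μ P)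
    (hP' : MemSH μ P') (hle : ∀ᵐ ℓ ∂μ, P ℓ ≤ P' ℓ) (hpos : UnifPos μ (opR μ g G R P)) :
    UnifPos μ (opR μ g G R P') := by
  obtain ⟨ξ, hξ, h⟩ := hpos
  refine ⟨ξ, hξ, h.mono fun ℓ hℓ => ?_⟩
  exact (Matrix.le_iff.2 hℓ).trans (add_le_add_right (hd.opT_mono G hP hP' hle ℓ) _)

omit [IsMarkovKernel 𝔾] in
/-- The closed-loop Lyapunov operator in terms of `𝒲`. -/
lemma sub_opT_closedLoop (hd : HasTransitionDensity μ 𝔾 g) (hR : MemSH μ R) {P : MatFun Θ n n}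
    (hP : MemSH μ P) (hpos : UnifPos μ (opR μ g G R P)) (K : MatFun Θ m n) :
    ∀ᵐ ℓ ∂μ, P ℓ - opT μ g (fun t => A t + G t * K t) P ℓ =
      Q ℓ + (K ℓ)ᵀ * R ℓ * K ℓ - opW μ g A G Q R P ℓ -
        (K ℓ - opM μ g A G R P ℓ)ᵀ * opR μ g G R P ℓ * (K ℓ - opM μ g A G R P ℓ) := by
  obtain ⟨ξ, hξ, h⟩ := hpos
  filter_upwards [h] with ℓ hℓ
  have key := completion_of_squares (A ℓ) (opE μ g P ℓ) (G ℓ) (K ℓ) (R ℓ)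
    (hd.opE_transpose hP.2 ℓ) (hR.2 ℓ) (isUnit_det_of_smul_one_le hξ (Matrix.le_iff.2 hℓ))
  simp only [opW, riccatiRHS, opM, opG, opR, opT]
  rw [← eq_sub_iff_add_eq] at key
  rw [key]
  abel

/-- One step of the Kleinman iteration. -/
structure KleinmanStep (μ : Measure Θ) (g : Θ → Θ → ℝ) (A : MatFun Θ n n) (G : MatFun Θ n m)
    (Q : MatFun Θ n n) (R : MatFun Θ m m) (K : MatFun Θ m n) (P : MatFun Θ n n) : Prop where
  gain : MemH μ K
  stable : LyapunovStable μ g (fun t => A t + G t * K t)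
  lyapunov : IsLyapunovSolution μ g A G Q R K P

namespace KleinmanStep

variable {K : MatFun Θ m n} {P P' : MatFun Θ n n}

/-- For `D = P - P'`, the closed-loop identity gives `D - T(D) = 𝒲(P')` plus a square weighted by
`ℛ(P') ≥ 0`; stability of the loop then gives `D ≥ 0`. -/
lemma le_of_mem_SPlus (hs : KleinmanStep μ g A G Q R K P) (hd : HasTransitionDensity μ 𝔾 g)
    (hR : MemSH μ R) (hP' : P' ∈ SPlus μ g A G Q R) : ∀ᵐ ℓ ∂μ, P' ℓ ≤ P ℓ := by
  obtain ⟨hP'm, ⟨ξ, hξ, hpos⟩, hW⟩ := hP'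
  obtain ⟨hPm, hP⟩ := hs.lyapunov
  have h := hs.stable.nonneg_of_opT_le hd (hPm.sub hP'm) ?_
  · exact h.mono fun ℓ h => sub_nonneg.1 h
  · filter_upwards [hpos, hW, hP, sub_opT_closedLoop (A := A) (Q := Q) hd hR hP'm ⟨ξ, hξ, hpos⟩ K]
      with ℓ h1 h2 h3 h4
    have h5 := conj_nonneg ((smul_one_nonneg hξ.le).trans (Matrix.le_iff.2 h1))
      (K ℓ - opM μ g A G R P' ℓ)
    have h6 := add_nonneg (Matrix.nonneg_iff_posSemidef.2 h2) h5
    rw [hd.opT_sub _ hPm hP'm, ← sub_nonneg, sub_sub_sub_comm, h3, h4]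
    convert h6 using 1
    abel

lemma unifPos (hs : KleinmanStep μ g A G Q R K P) (hd : HasTransitionDensity μ 𝔾 g)
    (hR : MemSH μ R) (hne : (SPlus μ g A G Q R).Nonempty) : UnifPos μ (opR μ g G R P) := by
  obtain ⟨P', hP'⟩ := hne
  exact UnifPos.opR_mono hd hP'.1 hs.lyapunov.1 (hs.le_of_mem_SPlus hd hR hP') hP'.2.1

omit [IsMarkovKernel 𝔾] in
lemma opW_eq (hs : KleinmanStep μ g A G Q R K P) (hd : HasTransitionDensity μ 𝔾 g)
    (hR : MemSH μ R) (hpos : UnifPos μ (opR μ g G R P)) :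
    ∀ᵐ ℓ ∂μ, opW μ g A G Q R P ℓ =
      -((opM μ g A G R P ℓ - K ℓ)ᵀ * opR μ g G R P ℓ * (opM μ g A G R P ℓ - K ℓ)) := by
  filter_upwards [hs.lyapunov.2,
    sub_opT_closedLoop (A := A) (Q := Q) hd hR hs.lyapunov.1 hpos K] with ℓ h1 h2
  rw [h1, sub_sub, eq_comm, sub_eq_self] at h2
  rw [← neg_sub (K ℓ), Matrix.transpose_neg, Matrix.neg_mul, Matrix.neg_mul, Matrix.mul_neg,
    neg_neg]
  exact eq_neg_of_add_eq_zero_left h2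

lemma next_gain (hs : KleinmanStep μ g A G Q R K P) (hd : HasTransitionDensity μ 𝔾 g)
    (hA : MemH μ A) (hG : MemH μ G) (hR : MemSH μ R) (hne : (SPlus μ g A G Q R).Nonempty) :
    MemH μ (opM μ g A G R P) :=
  opM_memH hd hA hG hR hs.lyapunov.1 (hs.unifPos hd hR hne)

/-- Take `Y = P - P'` with `P'` in `S₊`. Under the new gain, `Y - T(Y)` is at least `-𝒲(P)`, which
dominates `ξ DᵀD` for the gain change `D`. Hence `Y` supplies the energy bound that carries
stability from the old loop to the new one. -/
lemma next_stable (hs : KleinmanStep μ g A G Q R K P) (hd : HasTransitionDensity μ 𝔾 g)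
    (hA : MemH μ A) (hG : MemH μ G) (hR : MemSH μ R) (hne : (SPlus μ g A G Q R).Nonempty) :
    LyapunovStable μ g (fun t => A t + G t * opM μ g A G R P t) := by
  have hpos := hs.unifPos hd hR hne
  obtain ⟨P', hP'⟩ := hne
  have hle := hs.le_of_mem_SPlus hd hR hP'
  have hW := hs.opW_eq hd hR hpos
  obtain ⟨hP'm, ⟨ζ, hζ, hpos'⟩, hW'⟩ := hP'
  have hloop : (fun t => A t + G t * opM μ g A G R P t) = fun t =>
      (A t + G t * K t) + G t * (opM μ g A G R P t - K t) := by
    funext t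
    rw [Matrix.mul_sub]
    abel
  have e1 := sub_opT_closedLoop (A := A) (Q := Q) hd hR hs.lyapunov.1 hpos (opM μ g A G R P)
  have e2 := sub_opT_closedLoop (A := A) (Q := Q) hd hR hP'm ⟨ζ, hζ, hpos'⟩ (opM μ g A G R P)
  obtain ⟨ξ, hξ, hpos⟩ := hpos
  rw [hloop] at e1 e2 ⊢
  refine hs.stable.of_feedback hd (hA.add (hG.mul hs.gain)) hG (hs.lyapunov.1.sub hP'm)
    (hle.mono fun ℓ h => sub_nonneg.2 h) hξ ?_
  filter_upwards [hpos, hpos', hW, hW', e1, e2] with ℓ h1 h2 h3 h4 h5 h6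
  have h7 := conj_nonneg ((smul_one_nonneg hζ.le).trans (Matrix.le_iff.2 h2))
    (opM μ g A G R P ℓ - opM μ g A G R P' ℓ)
  have h8 := conj_mono (Matrix.le_iff.2 h1) (opM μ g A G R P ℓ - K ℓ)
  rw [Matrix.mul_smul, Matrix.mul_one, Matrix.smul_mul] at h8
  refine h8.trans ?_
  rw [hd.opT_sub _ hs.lyapunov.1 hP'm, ← sub_nonneg, sub_sub_sub_comm, h5, h6, h3, sub_self,
    Matrix.mul_zero]
  convert add_nonneg (Matrix.nonneg_iff_posSemidef.2 h4) h7 using 1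
  abel

/-- At the new gain the square in the closed-loop identity for `P` vanishes, so the difference has
Lyapunov residual `-𝒲(P) ≥ 0`. -/
lemma next_le (hs : KleinmanStep μ g A G Q R K P) (hd : HasTransitionDensity μ 𝔾 g)
    (hR : MemSH μ R) (hne : (SPlus μ g A G Q R).Nonempty)
    (hs' : KleinmanStep μ g A G Q R (opM μ g A G R P) P') : ∀ᵐ ℓ ∂μ, P' ℓ ≤ P ℓ := by
  have hpos := hs.unifPos hd hR hne
  have e1 := sub_opT_closedLoop (A := A) (Q := Q) hd hR hs.lyapunov.1 hpos (opM μ g A G R P)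
  have hW := hs.opW_eq hd hR hpos
  obtain ⟨ξ, hξ, hpos⟩ := hpos
  have h := hs'.stable.nonneg_of_opT_le hd (hs.lyapunov.1.sub hs'.lyapunov.1) ?_
  · exact h.mono fun ℓ h => sub_nonneg.1 h
  · filter_upwards [hpos, e1, hW, hs'.lyapunov.2] with ℓ h1 h2 h3 h4
    have h5 := conj_nonneg ((smul_one_nonneg hξ.le).trans (Matrix.le_iff.2 h1))
      (opM μ g A G R P ℓ - K ℓ)
    rw [hd.opT_sub _ hs.lyapunov.1 hs'.lyapunov.1, ← sub_nonneg, sub_sub_sub_comm, h2, h3, h4,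
      sub_self, Matrix.mul_zero]
    convert h5 using 1
    abel

end KleinmanStep

/-! ### Passage to the limit and construction of the iteration -/

section Convergence

variable {P : ℕ → MatFun Θ n n} {P' : MatFun Θ n n} {ℓ : Θ}

lemma tendsto_opT {a b : ℕ} {U : ℕ → MatFun Θ a a} {U' : MatFun Θ a a} (S : MatFun Θ a b)
    (hE : Tendsto (fun k => opE μ g (U k) ℓ) atTop (𝓝 (opE μ g U' ℓ))) :
    Tendsto (fun k => opT μ g S (U k) ℓ) atTop (𝓝 (opT μ g S U' ℓ)) :=
  tendsto_matrix_mul (tendsto_matrix_mul tendsto_const_nhds hE) tendsto_const_nhds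

lemma tendsto_opR (hE : Tendsto (fun k => opE μ g (P k) ℓ) atTop (𝓝 (opE μ g P' ℓ))) :
    Tendsto (fun k => opR μ g G R (P k) ℓ) atTop (𝓝 (opR μ g G R P' ℓ)) :=
  (tendsto_opT G hE).const_add _

lemma tendsto_opG (hE : Tendsto (fun k => opE μ g (P k) ℓ) atTop (𝓝 (opE μ g P' ℓ))) :
    Tendsto (fun k => opG μ g A G (P k) ℓ) atTop (𝓝 (opG μ g A G P' ℓ)) :=
  tendsto_matrix_mul (tendsto_matrix_mul tendsto_const_nhds hE) tendsto_const_nhds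

lemma tendsto_opM (hE : Tendsto (fun k => opE μ g (P k) ℓ) atTop (𝓝 (opE μ g P' ℓ)))
    (hdet : IsUnit (opR μ g G R P' ℓ).det) :
    Tendsto (fun k => opM μ g A G R (P k) ℓ) atTop (𝓝 (opM μ g A G R P' ℓ)) :=
  (tendsto_matrix_mul (tendsto_matrix_inv (tendsto_opR hE) hdet) (tendsto_opG hE)).neg

lemma tendsto_opW (hP : Tendsto (fun k => P k ℓ) atTop (𝓝 (P' ℓ)))
    (hE : Tendsto (fun k => opE μ g (P k) ℓ) atTop (𝓝 (opE μ g P' ℓ)))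
    (hdet : IsUnit (opR μ g G R P' ℓ).det) :
    Tendsto (fun k => opW μ g A G Q R (P k) ℓ) atTop (𝓝 (opW μ g A G Q R P' ℓ)) :=
  hP.neg.add (((tendsto_opT A hE).add_const _).sub (tendsto_matrix_mul
    (tendsto_matrix_mul (tendsto_matrix_transpose (tendsto_opG hE))
      (tendsto_matrix_inv (tendsto_opR hE) hdet)) (tendsto_opG hE)))

/-- The Kleinman iterates converge to a maximal solution. -/
lemma kleinman_tendsto (hd : HasTransitionDensity μ 𝔾 g) (hR : MemSH μ R)
    (hne : (SPlus μ g A G Q R).Nonempty) {K : ℕ → MatFun Θ m n}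
    (hs : ∀ h, KleinmanStep μ g A G Q R (K h) (P h))
    (hK : ∀ h, K (h + 1) = opM μ g A G R (P h)) :
    ∃ P' : MatFun Θ n n, IsMaximalSolution μ g A G Q R P' ∧ UnifPos μ (opR μ g G R P') ∧
      P' ∈ SPlus μ g A G Q R ∧ ∀ᵐ ℓ ∂μ, Tendsto (fun h => P h ℓ) atTop (𝓝 (P' ℓ)) := by
  have hanti : ∀ h, ∀ᵐ ℓ ∂μ, P (h + 1) ℓ ≤ P h ℓ := fun h =>
    (hs h).next_le hd hR hne (by rw [← hK]; exact hs (h + 1))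
  obtain ⟨P₀, hP₀⟩ := id hne
  obtain ⟨P', hP', hlim, r, hr⟩ := exists_memSH_tendsto_of_antitone
    (fun h => (hs h).lyapunov.1) hP₀.1 hanti (fun h => (hs h).le_of_mem_SPlus hd hR hP₀)
  have hmax : ∀ P'' ∈ SPlus μ g A G Q R, ∀ᵐ ℓ ∂μ, P'' ℓ ≤ P' ℓ := fun P'' hP'' => by
    filter_upwards [hlim, ae_all_iff.2 fun h => (hs h).le_of_mem_SPlus hd hR hP''] with ℓ h1 h2
    exact matrix_le_of_tendsto tendsto_const_nhds h1 h2
  -- Positivity at the limit comes from an element of `S₊` below it, so no uniformity along the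
  -- iteration is required.
  have hpos : UnifPos μ (opR μ g G R P') :=
    UnifPos.opR_mono hd hP₀.1 hP' (hmax P₀ hP₀) hP₀.2.1
  have hE := hd.opE_tendsto (fun h => (hs h).lyapunov.1.1.1) hr hlim
  have hW : ∀ᵐ ℓ ∂μ, opW μ g A G Q R P' ℓ = 0 := by
    obtain ⟨ξ, hξ, hpos⟩ := hpos
    filter_upwards [hlim, hpos,
      ae_all_iff.2 fun h => (hs h).opW_eq hd hR ((hs h).unifPos hd hR hne)] with ℓ h1 h2 h3
    have hdet := isUnit_det_of_smul_one_le hξ (Matrix.le_iff.2 h2)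
    -- The initial gain need not be a value of `ℳ`, so the residual is read at `h + 1`, where both
    -- gains in the increment are values of `ℳ`.
    have hshift := tendsto_add_atTop_nat 1
    have hM := tendsto_opM (A := A) (hE ℓ) hdet
    have hD := (hM.comp hshift).sub hM
    have h4 := (tendsto_matrix_mul (tendsto_matrix_mul (tendsto_matrix_transpose hD)
      ((tendsto_opR (G := G) (R := R) (hE ℓ)).comp hshift)) hD).neg
    rw [sub_self, Matrix.mul_zero, neg_zero] at h4
    refine tendsto_nhds_unique ((tendsto_opW (A := A) (Q := Q) h1 (hE ℓ) hdet).comp hshift)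
      (h4.congr fun h => ?_)
    have h5 := h3 (h + 1)
    rw [hK] at h5
    exact h5.symm
  refine ⟨P', ⟨⟨hP', ?_⟩, hmax⟩, hpos, ⟨hP', hpos, ?_⟩, hlim⟩
  · filter_upwards [hW] with ℓ h
    rw [opW, neg_add_eq_zero] at h
    exact h
  · filter_upwards [hW] with ℓ h
    rw [h]
    exact Matrix.PosSemidef.zero

/-- The Kleinman iteration started at a stabilizing gain is well defined. -/
lemma exists_kleinmanIteration (hd : HasTransitionDensity μ 𝔾 g) (hA : MemH μ A) (hG : MemH μ G)
    (hQ : MemSH μ Q) (hR : MemSH μ R) (hne : (SPlus μ g A G Q R).Nonempty) {K₀ : MatFun Θ m n}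
    (hK₀ : MemH μ K₀) (hst : LyapunovStable μ g (fun t => A t + G t * K₀ t)) :
    ∃ (K : ℕ → MatFun Θ m n) (P : ℕ → MatFun Θ n n), IsKleinmanIteration μ g A G Q R K₀ K P := by
  -- The recursion runs on the subtype of bounded stabilizing gains, where the Lyapunov equation is
  -- always solvable.
  have hsol : ∀ K : {K : MatFun Θ m n // MemH μ K ∧
      LyapunovStable μ g (fun t => A t + G t * K t)}, ∃ P, KleinmanStep μ g A G Q R K.1 P := by
    rintro ⟨K, hK, hst⟩
    obtain ⟨P, hP, h⟩ := hst.exists_solution hd (hA.add (hG.mul hK)) (hQ.add (hR.conj hK))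
    exact ⟨P, hK, hst, hP, h⟩
  choose sol hsol using hsol
  let next : {K : MatFun Θ m n // MemH μ K ∧ LyapunovStable μ g (fun t => A t + G t * K t)} →
      {K : MatFun Θ m n // MemH μ K ∧ LyapunovStable μ g (fun t => A t + G t * K t)} := fun K =>
    ⟨opM μ g A G R (sol K), (hsol K).next_gain hd hA hG hR hne,
      (hsol K).next_stable hd hA hG hR hne⟩
  refine ⟨fun h => (next^[h] ⟨K₀, hK₀, hst⟩).1, fun h => sol (next^[h] ⟨K₀, hK₀, hst⟩), rfl,
    fun h => ?_, fun h => (hsol _).lyapunov⟩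
  simp only [Function.iterate_succ_apply']
  rfl

lemma IsKleinmanIteration.step_of_stable (hd : HasTransitionDensity μ 𝔾 g) (hA : MemH μ A)
    (hG : MemH μ G) (hR : MemSH μ R) (hne : (SPlus μ g A G Q R).Nonempty)
    {K₀ : MatFun Θ m n} {K : ℕ → MatFun Θ m n} (hit : IsKleinmanIteration μ g A G Q R K₀ K P)
    (hK₀ : MemH μ K₀) (hst : LyapunovStable μ g (fun t => A t + G t * K₀ t)) (h : ℕ) :
    KleinmanStep μ g A G Q R (K h) (P h) := by
  induction h with
  | zero =>
    have h0 := hit.lyapunov 0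
    rw [hit.init] at h0 ⊢
    exact ⟨hK₀, hst, h0⟩
  | succ h ih =>
    have h1 := hit.lyapunov (h + 1)
    rw [hit.step h] at h1 ⊢
    exact ⟨ih.next_gain hd hA hG hR hne, ih.next_stable hd hA hG hR hne, h1⟩

end Convergence

end Riccati

end MJLS

end

/-! ### The main theorem -/

open MJLS
theorem theorem4 {Θ : Type u} [MeasurableSpace Θ] [StandardBorelSpace Θ]
    (μ : Measure Θ) [SigmaFinite μ]
    (𝔾 : Kernel Θ Θ) [IsMarkovKernel 𝔾]
    (g : Θ → Θ → ℝ) (hg_nonneg : ∀ ℓ t, 0 ≤ g ℓ t) (hg_meas : ∀ ℓ, Measurable (g ℓ))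
    (hg : ∀ ℓ, 𝔾 ℓ = μ.withDensity fun t => ENNReal.ofReal (g ℓ t))
    {n m : ℕ}
    (A : MatFun Θ n n) (hA : MemH μ A) (G : MatFun Θ n m) (hG : MemH μ G)
    (Q : MatFun Θ n n) (hQ : MemSH μ Q)
    (R : MatFun Θ m m) (hR : MemSH μ R) (hR_pos : UnifPos μ R)
    (hstab : Stabilizable μ 𝔾 A G)
    (hne : (SPlus μ g A G Q R).Nonempty) :
    ∃ Pmax : MatFun Θ n n,
      IsMaximalSolution μ g A G Q R Pmax ∧
      UnifPos μ (opR μ g G R Pmax) ∧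
      ∀ K₀ : MatFun Θ m n, IsStabilizingGain μ 𝔾 A G K₀ →
        (∃ (K : ℕ → MatFun Θ m n) (P : ℕ → MatFun Θ n n),
          IsKleinmanIteration μ g A G Q R K₀ K P) ∧
        ∀ (K : ℕ → MatFun Θ m n) (P : ℕ → MatFun Θ n n),
          IsKleinmanIteration μ g A G Q R K₀ K P →
          (∀ h, IsStabilizingGain μ 𝔾 A G (K h)) ∧
          (∀ h, UnifPos μ (opR μ g G R (P h))) ∧
          (∀ h P', IsLyapunovSolution μ g A G Q R (K h) P' → P' =ᵐ[μ] P h) ∧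
          (∀ h, LeAE μ (P (h + 1)) (P h)) ∧
          (∀ h, ∀ P' ∈ SPlus μ g A G Q R, LeAE μ P' (P h)) ∧
          ∀ᵐ ℓ ∂μ, Tendsto (fun h => P h ℓ) atTop (𝓝 (Pmax ℓ)) := by
  have hd : HasTransitionDensity μ 𝔾 g := ⟨hg_nonneg, hg_meas, hg⟩
  have hstable : ∀ K : MatFun Θ m n, MemH μ K → (EMSS μ 𝔾 (fun ℓ => A ℓ + G ℓ * K ℓ) ↔
      LyapunovStable μ g (fun ℓ => A ℓ + G ℓ * K ℓ)) := fun K hK =>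
    emss_iff_lyapunovStable hd (hA.add (hG.mul hK))
  have hconv : ∀ K₀ : MatFun Θ m n, IsStabilizingGain μ 𝔾 A G K₀ →
      ∀ (K : ℕ → MatFun Θ m n) (P : ℕ → MatFun Θ n n),
        IsKleinmanIteration μ g A G Q R K₀ K P →
        (∀ h, KleinmanStep μ g A G Q R (K h) (P h)) ∧
        ∃ P' : MatFun Θ n n, IsMaximalSolution μ g A G Q R P' ∧ UnifPos μ (opR μ g G R P') ∧
          P' ∈ SPlus μ g A G Q R ∧ ∀ᵐ ℓ ∂μ, Tendsto (fun h => P h ℓ) atTop (𝓝 (P' ℓ)) := by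
    intro K₀ hK₀ K P hit
    have hs := hit.step_of_stable hd hA hG hR hne hK₀.1 ((hstable K₀ hK₀.1).1 hK₀.2)
    exact ⟨hs, kleinman_tendsto hd hR hne hs hit.step⟩
  have hexists : ∀ K₀ : MatFun Θ m n, IsStabilizingGain μ 𝔾 A G K₀ →
      ∃ (K : ℕ → MatFun Θ m n) (P : ℕ → MatFun Θ n n), IsKleinmanIteration μ g A G Q R K₀ K P :=
    fun K₀ hK₀ => exists_kleinmanIteration hd hA hG hQ hR hne hK₀.1 ((hstable K₀ hK₀.1).1 hK₀.2)
  obtain ⟨K₁, hK₁⟩ := hstab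
  obtain ⟨K, P, hit⟩ := hexists K₁ hK₁
  obtain ⟨-, Pmax, hmax, hpos, hmem, -⟩ := hconv K₁ hK₁ K P hit
  refine ⟨Pmax, hmax, hpos, fun K₀ hK₀ => ⟨hexists K₀ hK₀, fun K P hit => ?_⟩⟩
  obtain ⟨hs, P', hmax', -, hmem', hlim⟩ := hconv K₀ hK₀ K P hit
  refine ⟨fun h => ⟨(hs h).gain, (hstable _ (hs h).gain).2 (hs h).stable⟩,
    fun h => (hs h).unifPos hd hR hne, fun h P'' hP'' => ?_,
    fun h => (hs h).next_le hd hR hne (by rw [← hit.step]; exact hs (h + 1)),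
    fun h P'' hP'' => (hs h).le_of_mem_SPlus hd hR hP'', ?_⟩
  · refine (hs h).stable.ae_eq hd hP''.1 (hs h).lyapunov.1 ?_
    filter_upwards [hP''.2, (hs h).lyapunov.2] with ℓ h1 h2
    rw [h1, h2]
  -- `Pmax` was built from one fixed gain. Both limits lie in `S₊` and are maximal over it, so they
  -- agree almost everywhere.
  · filter_upwards [hlim, hmax.2 P' hmem', hmax'.2 Pmax hmem] with ℓ h1 h2 h3
    have heq : P' ℓ = Pmax ℓ := Matrix.instPartialOrder.le_antisymm _ _ h2 h3
    rwa [heq] at h1
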